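/- Fix an integer $k\ge 0$. Let $\mathcal L$ be the set of all line segments joining consecutive integral points on lines of slope $0$, $\infty$ or $-1$ through integral points of the plane. Let $(p,q)\in\mathbb Z^2\setminus\{(0,0)\}$ and let $\gamma$ be the line segment from $(0,0)$ to $(p,q)$, deformed slightly to the left at every interior point of it that lies in $(\frac12\mathbb Z)^2$ (so that, in particular, it passes to the left of each integral point in its interior). Let $\mathcal P_{(p,q)}$ be the poset whose elements are the pairs $(\tau,i)$ with $\tau\in\mathcal L$ a segment crossed by $\gamma$ and $0\le i\le k$, and whose order is generated by the following relations: $(\tau,0)\succ(\tau,1)\succ\dots\succ(\tau,k)$ if $\gamma$ crosses $\tau$ strictly closer to the endpoint of $\tau$ to the right of $\gamma$, and $(\tau,0)\prec(\tau,1)\prec\dots\prec(\tau,k)$ otherwise; if $\gamma$ crosses $\tau$ and $\tau'$ consecutively in this order, then $(\tau,k)\succ(\tau',0)$ if the common endpoint of $\tau$ and $\tau'$ is to the right of $\gamma$, and $(\tau,k)\prec(\tau',0)$ if it is to the left. Let $m^{(k)}_{(p,q)}$ be the number of order ideals (down-closed subsets, including $\emptyset$) of $\mathcal P_{(p,q)}$,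 and put $m^{(k)}_{(0,0)}=0$. For coprime $p,q$ write $m^{(k)}_{q/p}=m^{(k)}_{(p,q)}$. Proposition. Let $p$ and $q$ be coprime integers and let $\eta=(3+3k)\,m^{(k)}_{q/p}-k$. The sequence $\big(m^{(k)}_{(np,nq)}\big)_{n\ge 0}$ satisfies $$m^{(k)}_{((n+2)p,(n+2)q)}=\big((3+3k)\,m^{(k)}_{q/p}-k\big)\,m^{(k)}_{((n+1)p,(n+1)q)}-m^{(k)}_{(np,nq)}\qquad(n\ge 0)$$ with initial conditions $m^{(k)}_{(0,0)}=0$ and $m^{(k)}_{(p,q)}=m^{(k)}_{q/p}$. Consequently, $\eta>2$ and, for all $n\ge 0$, $$m^{(k)}_{(np,nq)}=\frac{m^{(k)}_{q/p}}{\sqrt{\eta^2-4}}\left(\frac{\eta+\sqrt{\eta^2-4}}{2}\right)^n-\frac{m^{(k)}_{q/p}}{\sqrt{\eta^2-4}}\left(\frac{\eta-\sqrt{\eta^2-4}}{2}\right)^n.$$ -/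

import Mathlib

namespace KMarkov

/-- Integral points of the plane. -/
abbrev Pt : Type := ℤ × ℤ

/-- The determinant of two integral vectors; `0 < det d v` says that `v` lies strictly to the left
of the directed line through the origin with direction `d`. -/
def det (u v : Pt) : ℤ := u.1 * v.2 - u.2 * v.1

/-- `a` and `b` are the endpoints of a segment of the lattice `𝓛`, i.e. they are consecutive
integral points on a line of slope `0`, `∞` or `-1`. -/
def IsSegment (a b : Pt) : Prop :=
  b - a = (1, 0) ∨ b - a = (-1, 0) ∨ b - a = (0, 1) ∨ b - a = (0, -1) ∨
    b - a = (1, -1) ∨ b - a = (-1, 1)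

/-- For a segment with endpoints `a`, `b` on different sides of the directed line `ℝ d`, the number
`t` such that the segment meets this line in the point `t • d`. -/
def time (d a b : Pt) : ℚ := (det a b : ℚ) / ((det d b - det d a : ℤ) : ℚ)

/-- For a segment with endpoints `a`, `b` on different sides of the directed line `ℝ d`, the number
`s` such that the segment meets this line in the point `a + s • (b - a)`. -/
def fraction (d a b : Pt) : ℚ := (det d a : ℚ) / ((det d a - det d b : ℤ) : ℚ)

/-- The meaning of `time` and `fraction`: both describe the intersection point. -/
theorem meeting_point (d a b : Pt) (h : det d a ≠ det d b) :
    (a.1 : ℚ) + fraction d a b * ((b.1 : ℚ) - a.1) = time d a b * d.1 ∧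
      (a.2 : ℚ) + fraction d a b * ((b.2 : ℚ) - a.2) = time d a b * d.2 := by
  have h1 : ((det d a - det d b : ℤ) : ℚ) ≠ 0 := by
    exact_mod_cast sub_ne_zero.mpr h
  have h2 : ((det d b - det d a : ℤ) : ℚ) ≠ 0 := by
    exact_mod_cast sub_ne_zero.mpr h.symm
  unfold fraction time
  constructor
  · field_simp
    simp only [det]
    push_cast
    ring
  · field_simp
    simp only [det]
    push_cast
    ring

/-- The crossings of the curve `γ^L_d` with the segments of `𝓛`, where `γ^L_d` is the line segment
from the origin to `d`, pushed slightly to the left at all integral and half-integral points in its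
interior.

A crossing is recorded as the crossed segment, with its endpoint `left` to the left of the curve and
its endpoint `right` to the right of the curve. There are two ways in which it can arise:
* `det d right < 0`: the open line segment from the origin to `d` crosses the segment transversally;
* `det d right = 0`: `right` is an integral point in the open line segment from the origin to `d`,
  and the curve passes it on its left, so crosses the segments which leave `right` to the left. -/
structure Crossing (d : Pt) where
  left : Pt
  right : Pt
  isSegment : IsSegment left right
  left_pos : 0 < det d left
  right_nonpos : det d right ≤ 0
  time_pos : 0 < time d left right
  time_lt_one : time d left right < 1

variable {d : Pt}

/-- The curve crosses the segment at a point strictly closer to its right endpoint. (If the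
undeformed line passes through the midpoint, then the left deformation makes it closer to the left
endpoint.) -/
def Crossing.NearRight (c : Crossing d) : Prop := 1 / 2 < fraction d c.left c.right

/-- The curve meets the crossing `c` before the crossing `c'`. Two crossings with the same time
belong to the detour around a common integral point `c.right = c'.right`; this detour on the left
runs clockwise. -/
def Crossing.Before (c c' : Crossing d) : Prop :=
  time d c.left c.right < time d c'.left c'.right ∨
    (time d c.left c.right = time d c'.left c'.right ∧
      0 < det (c'.left - c'.right) (c.left - c.right))

/-- The curve crosses `c` and `c'` consecutively in this order. -/
def Crossing.Next (c c' : Crossing d) : Prop :=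
  c.Before c' ∧ ¬ ∃ e : Crossing d, c.Before e ∧ e.Before c'

/-- The elements `(τ, i)` with `τ` a crossing and `0 ≤ i ≤ k` of the fence poset. -/
abbrev FenceElem (k : ℕ) (d : Pt) : Type := Crossing d × Fin (k + 1)

/-- The generating relations `x ≺ y` of the fence poset `𝓟_d`. -/
inductive FenceStep (k : ℕ) (d : Pt) : FenceElem k d → FenceElem k d → Prop
  /-- The chain `(τ, 0) ≻ (τ, 1) ≻ ⋯ ≻ (τ, k)` at a crossing closer to the right endpoint. -/
  | chainDown (c : Crossing d) (hc : c.NearRight) (i : Fin k) :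
      FenceStep k d (c, i.succ) (c, i.castSucc)
  /-- The chain `(τ, 0) ≺ (τ, 1) ≺ ⋯ ≺ (τ, k)` at any other crossing. -/
  | chainUp (c : Crossing d) (hc : ¬ c.NearRight) (i : Fin k) :
      FenceStep k d (c, i.castSucc) (c, i.succ)
  /-- `(τ, k) ≻ (τ', 0)` if the common endpoint of `τ` and `τ'` is to the right of the curve. -/
  | linkDown (c c' : Crossing d) (hn : c.Next c') (he : c.right = c'.right) :
      FenceStep k d (c', 0) (c, Fin.last k)
  /-- `(τ, k) ≺ (τ', 0)` if the common endpoint of `τ` and `τ'` is to the left of the curve. -/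
  | linkUp (c c' : Crossing d) (hn : c.Next c') (he : c.left = c'.left) :
      FenceStep k d (c, Fin.last k) (c', 0)

/-- The order `x ≼ y` of the fence poset `𝓟_d`. -/
def FenceLe (k : ℕ) (d : Pt) : FenceElem k d → FenceElem k d → Prop :=
  Relation.ReflTransGen (FenceStep k d)

/-- The set of order ideals of the fence poset `𝓟_d`. -/
def orderIdeals (k : ℕ) (d : Pt) : Set (Set (FenceElem k d)) :=
  {I | ∀ x ∈ I, ∀ y, FenceLe k d y x → y ∈ I}

/-- The numbers `m^{(k)}_{(p,q)}` for all integral points `(p,q)`: the number of order ideals of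
`𝓟_{(p,q)}` if `(p,q)` is not the origin, and `0` for the origin. -/
noncomputable def m (k : ℕ) (p q : ℤ) : ℕ :=
  if p = 0 ∧ q = 0 then 0 else (orderIdeals k (p, q)).ncard

end KMarkov

namespace KMarkov

/-! The crossings of the curve are linearly ordered, so the poset is a fence: its elements form a
line and the generating relations compare neighbours only. An order ideal is thus a 0/1 word in
which each pair of neighbours satisfies one implication, and such words are counted by the entry sum
of a product of unipotent `2 × 2` matrices (`ncard_stepOk`, `ncard_orderIdeals_eq`).

A lattice rotation moves the direction into the sector `0 < x`, `0 ≤ y`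
(`exists_isLatticeRotation`), where the crossed segments can be listed explicitly. Let `M` be the
matrix of a primitive vector `e` with `0 < e.2`. Translation by `e` repeats the fence, and the
detour around each interior multiple of `e` inserts a fixed matrix `D = detourMatrix k`, so the
multiple `n + 1` has the matrix `(M * D) ^ n * M` (`fenceMatrix_edge`).

The half-turn about the midpoint of the primitive segment reverses the fence and exchanges left and
right. Transposition does the same to a product of step matrices, so `M = A * F ^ k * Aᵀ` with `F =
stepMatrix false` for the central chain and `A.det = 1`. This gives `M 0 1 - M 1 0 = -k`
(`fenceMatrix_edge_palindrome`), hence the trace of `M * D` is `(3 + 3k) * entrySum M - k`, and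
Cayley–Hamilton is the recurrence (`entrySum_recurrence`). A primitive vector along a segment of the
lattice has an empty fence; there `segmentMatrix` replaces `M` with the same properties
(`exists_matrix`). -/

open Matrix

/-! ### Transfer matrices and the count of fence ideals -/

/-- The transfer matrix of a step `t ≻ t + 1` (for `true`) or `t ≺ t + 1` (for `false`). -/
def stepMatrix : Bool → Matrix (Fin 2) (Fin 2) ℤ
  | true => !![1, 1; 0, 1]
  | false => !![1, 0; 1, 1]

theorem transpose_stepMatrix (b : Bool) : (stepMatrix b)ᵀ = stepMatrix (!b) := by
  cases b <;> ext i j <;> fin_cases i <;> fin_cases j <;> rfl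

theorem det_stepMatrix (b : Bool) : (stepMatrix b).det = 1 := by
  cases b <;> simp [stepMatrix, Matrix.det_fin_two]

theorem stepMatrix_true_pow (n : ℕ) : stepMatrix true ^ n = !![1, (n : ℤ); 0, 1] := by
  induction n with
  | zero => ext i j; fin_cases i <;> fin_cases j <;> rfl
  | succ n ih => rw [pow_succ, ih]; simp [stepMatrix, add_comm]

theorem stepMatrix_false_pow (n : ℕ) : stepMatrix false ^ n = !![1, 0; (n : ℤ), 1] := by
  induction n with
  | zero => ext i j; fin_cases i <;> fin_cases j <;> rfl
  | succ n ih => rw [pow_succ, ih]; simp [stepMatrix]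

/-- The ordered product `T i * T (i + 1) * ⋯ * T (i + n - 1)`. -/
def consecutiveProd {R : Type*} [Monoid R] (T : ℕ → R) (i : ℕ) : ℕ → R
  | 0 => 1
  | n + 1 => consecutiveProd T i n * T (i + n)

theorem consecutiveProd_add {R : Type*} [Monoid R] (T : ℕ → R) (i a b : ℕ) :
    consecutiveProd T i (a + b) = consecutiveProd T i a * consecutiveProd T (i + a) b := by
  induction b with
  | zero => simp [consecutiveProd]
  | succ b ih => rw [← add_assoc, consecutiveProd, ih, consecutiveProd, mul_assoc, add_assoc]

theorem consecutiveProd_one {R : Type*} [Monoid R] (T : ℕ → R) (i : ℕ) :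
    consecutiveProd T i 1 = T i := by simp [consecutiveProd]

theorem consecutiveProd_congr {R : Type*} [Monoid R] (T T' : ℕ → R) (i i' n : ℕ)
    (h : ∀ t < n, T (i + t) = T' (i' + t)) :
    consecutiveProd T i n = consecutiveProd T' i' n := by
  induction n with
  | zero => rfl
  | succ n ih =>
    rw [consecutiveProd, consecutiveProd, ih fun t ht => h t (by omega), h n (by omega)]

theorem consecutiveProd_const {R : Type*} [Monoid R] (T : ℕ → R) (i n : ℕ) (x : R)
    (h : ∀ t < n, T (i + t) = x) : consecutiveProd T i n = x ^ n := by
  induction n with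
  | zero => simp [consecutiveProd]
  | succ n ih =>
    rw [consecutiveProd, ih fun t ht => h t (by omega), h n (by omega), pow_succ]

theorem consecutiveProd_periodic {R : Type*} [Monoid R] (T : ℕ → R) (l : ℕ)
    (h : ∀ j, T (j + l) = T j) (i n : ℕ) :
    consecutiveProd T i (l * n) = consecutiveProd T i l ^ n := by
  have hs : ∀ n t, T (i + l * n + t) = T (i + t) := by
    intro n t
    induction n with
    | zero => simp
    | succ n ih => rw [← ih, ← h (i + l * n + t)]; congr 1; ring
  induction n with
  | zero => simp [consecutiveProd]
  | succ n ih =>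
    rw [mul_add, mul_one, consecutiveProd_add, ih, pow_succ,
      consecutiveProd_congr T T (i + l * n) i l fun t _ => hs n t]

theorem det_consecutiveProd (T : ℕ → Matrix (Fin 2) (Fin 2) ℤ) (h : ∀ j, (T j).det = 1)
    (i n : ℕ) : (consecutiveProd T i n).det = 1 := by
  induction n with
  | zero => simp [consecutiveProd]
  | succ n ih => rw [consecutiveProd, Matrix.det_mul, ih, h, one_mul]

/-- The sum of all entries of a `2 × 2` matrix. -/
def entrySum (M : Matrix (Fin 2) (Fin 2) ℤ) : ℤ := M 0 0 + M 0 1 + M 1 0 + M 1 1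

/-- The free vector `u` serves the induction: the last step matrix is absorbed into it. -/
theorem sum_prod_stepMatrix (w : ℕ → Bool) (n : ℕ) (u : Fin 2 → ℤ) :
    ∑ x : Fin (n + 1) → Fin 2,
      (∏ t : Fin n, stepMatrix (w t) (x t.castSucc) (x t.succ)) * u (x (Fin.last n)) =
    ∑ z, (consecutiveProd (fun t => stepMatrix (w t)) 0 n *ᵥ u) z := by
  induction n generalizing u with
  | zero =>
    rw [← (Equiv.funUnique (Fin 1) (Fin 2)).symm.sum_comp]
    simp [consecutiveProd]
  | succ n ih =>
    rw [consecutiveProd, ← Matrix.mulVec_mulVec, ← ih,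
      ← (Fin.snocEquiv fun _ : Fin (n + 2) => Fin 2).sum_comp, Fintype.sum_prod_type,
      Finset.sum_comm]
    refine Finset.sum_congr rfl fun x _ => ?_
    simp only [Fin.snocEquiv_apply, Fin.prod_univ_castSucc, Fin.succ_castSucc, Fin.snoc_castSucc,
      Fin.succ_last, Fin.snoc_last, Fin.val_castSucc, Fin.val_last, zero_add, mul_assoc,
      ← Finset.mul_sum]
    rfl

/-- The relation between the indicators of membership in an order ideal at two consecutive elements
`t`, `t + 1` of a fence, where `b = true` means `t ≻ t + 1`. -/
def StepOk (b : Bool) (y z : Prop) : Prop := if b then (y → z) else (z → y)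

theorem stepMatrix_apply (b : Bool) (y z : Fin 2) [Decidable (StepOk b (y = 1) (z = 1))] :
    stepMatrix b y z = if StepOk b (y = 1) (z = 1) then 1 else 0 := by
  revert y z
  cases b <;> intro y z <;> fin_cases y <;> fin_cases z <;> intro h <;>
    simp [stepMatrix, StepOk]

/-- Each matrix entry is the indicator of an admissible pair of memberships, so the product along a
word is the indicator of an ideal. Summing all entries leaves both end memberships free. -/
theorem ncard_stepOk (w : ℕ → Bool) (n : ℕ) :
    ({x : Fin (n + 1) → Prop | ∀ t : Fin n, StepOk (w t) (x t.castSucc) (x t.succ)}.ncard : ℤ) =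
      entrySum (consecutiveProd (fun t => stepMatrix (w t)) 0 n) := by
  classical
  have hinj : Function.Injective fun (x : Fin (n + 1) → Fin 2) (t : Fin (n + 1)) => x t = 1 := by
    intro x y h
    funext t
    have := congrFun h t
    simp only [eq_iff_iff] at this
    omega
  have himg : {x : Fin (n + 1) → Prop | ∀ t : Fin n, StepOk (w t) (x t.castSucc) (x t.succ)} =
      (fun (x : Fin (n + 1) → Fin 2) (t : Fin (n + 1)) => x t = 1) ''
        {x | ∀ t : Fin n, StepOk (w t) (x t.castSucc = 1) (x t.succ = 1)} := by
    ext x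
    simp only [Set.mem_ofPred_eq, Set.mem_image]
    constructor
    · intro h
      have hx : (fun t => (if x t then (1 : Fin 2) else 0) = 1) = x := by
        funext t
        by_cases ht : x t <;> simp [ht]
      refine ⟨fun t => if x t then 1 else 0, fun t => ?_, hx⟩
      have h1 := congrFun hx t.castSucc
      have h2 := congrFun hx t.succ
      rw [h1, h2]
      exact h t
    · rintro ⟨y, hy, rfl⟩
      exact hy
  rw [himg, Set.ncard_image_of_injective _ hinj, Set.ncard_eq_toFinset_card']
  have := sum_prod_stepMatrix w n 1
  simp only [stepMatrix_apply, Pi.one_apply, Finset.mem_univ, true_imp_iff, mul_one,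
    Finset.prod_ite_zero, Finset.prod_const_one,
    Finset.sum_boole] at this
  rw [Set.toFinset_ofPred, this]
  simp [entrySum, Matrix.mulVec, dotProduct, Fin.sum_univ_two]
  ring

/-! ### Cayley–Hamilton, the recurrence and its closed form -/

theorem sq_eq_trace_smul_sub (X : Matrix (Fin 2) (Fin 2) ℤ) :
    X * X = X.trace • X - X.det • 1 := by
  have hδ := Matrix.det_fin_two X
  generalize X.det = δ at hδ
  ext i j
  rw [Matrix.sub_apply, Matrix.smul_apply, Matrix.smul_apply]
  fin_cases i <;> fin_cases j <;>
    simp [Matrix.mul_apply, Matrix.trace, Fin.sum_univ_two] <;> (try rw [hδ]) <;> ring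

/-- The transfer matrix of the detour around an integral point. -/
def detourMatrix (k : ℕ) : Matrix (Fin 2) (Fin 2) ℤ :=
  stepMatrix false * stepMatrix true ^ (3 * k + 2) * stepMatrix false

theorem detourMatrix_eq (k : ℕ) :
    detourMatrix k = !![3 * (k : ℤ) + 3, 3 * k + 2; 3 * k + 4, 3 * k + 3] := by
  rw [detourMatrix, stepMatrix_true_pow]
  ext i j
  fin_cases i <;> fin_cases j <;>
    simp [stepMatrix, Matrix.mul_apply, Fin.sum_univ_two] <;> ring

/-- Cayley–Hamilton for `X = M * detourMatrix k`, of determinant `1`. The first conjunct is the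
recurrence with preceding term `X⁻¹ * M = (detourMatrix k)⁻¹`; the entries of that inverse sum to
`0`, in agreement with the value at the origin. -/
theorem entrySum_recurrence (k : ℕ) (M : Matrix (Fin 2) (Fin 2) ℤ) (hdet : M.det = 1)
    (hM : M 0 1 - M 1 0 = -k) :
    entrySum ((M * detourMatrix k) ^ 1 * M) = ((3 + 3 * k) * entrySum M - k) * entrySum M ∧
    ∀ n, entrySum ((M * detourMatrix k) ^ (n + 2) * M) =
      ((3 + 3 * k) * entrySum M - k) * entrySum ((M * detourMatrix k) ^ (n + 1) * M) -
        entrySum ((M * detourMatrix k) ^ n * M) := by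
  have htr : (M * detourMatrix k).trace = (3 + 3 * k) * entrySum M - k := by
    rw [detourMatrix_eq]
    simp [Matrix.trace, Fin.sum_univ_two, Matrix.mul_apply, entrySum]
    linear_combination hM
  have hdet' : (M * detourMatrix k).det = 1 := by
    rw [Matrix.det_mul, hdet, detourMatrix_eq, Matrix.det_fin_two]
    simp
    ring
  constructor
  · rw [← htr, pow_one, detourMatrix_eq]
    rw [Matrix.det_fin_two] at hdet
    simp [Matrix.trace, Fin.sum_univ_two, Matrix.mul_apply, entrySum]
    linear_combination 0 * hdet
  · intro n
    have h := sq_eq_trace_smul_sub (M * detourMatrix k)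
    rw [htr, hdet', one_smul] at h
    have h2 : (M * detourMatrix k) ^ (n + 2) * M =
        ((3 + 3 * k) * entrySum M - k) • ((M * detourMatrix k) ^ (n + 1) * M) -
          (M * detourMatrix k) ^ n * M := by
      rw [pow_add, sq, h, pow_succ]
      simp only [mul_sub, sub_mul, mul_smul_comm, smul_mul_assoc, mul_one]
    rw [h2]
    simp only [entrySum, Matrix.sub_apply, Matrix.smul_apply, smul_eq_mul]
    ring

theorem closed_form (u : ℕ → ℝ) (η : ℝ) (hη : 2 < η) (h0 : u 0 = 0)
    (h : ∀ n, u (n + 2) = η * u (n + 1) - u n) (n : ℕ) :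
    u n = u 1 / √(η ^ 2 - 4) * ((η + √(η ^ 2 - 4)) / 2) ^ n -
      u 1 / √(η ^ 2 - 4) * ((η - √(η ^ 2 - 4)) / 2) ^ n := by
  have hpos : 0 < η ^ 2 - 4 := by nlinarith
  have hs : √(η ^ 2 - 4) ^ 2 = η ^ 2 - 4 := Real.sq_sqrt hpos.le
  have hs0 : √(η ^ 2 - 4) ≠ 0 := (Real.sqrt_pos.mpr hpos).ne'
  generalize √(η ^ 2 - 4) = s at hs hs0 ⊢
  induction n using Nat.twoStepInduction with
  | zero => simp [h0]
  | one => field_simp; ring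
  | more n ih1 ih2 =>
    rw [h, ih2, ih1]
    -- Both bases are roots of the characteristic equation `x ^ 2 = η * x - 1`.
    have e1 : ((η + s) / 2) ^ 2 = η * ((η + s) / 2) - 1 := by linear_combination hs / 4
    have e2 : ((η - s) / 2) ^ 2 = η * ((η - s) / 2) - 1 := by linear_combination hs / 4
    rw [pow_add _ n 2, pow_add _ n 2, e1, e2]
    ring

/-! ### From the poset to the fence matrix -/

/-- The transfer matrix of the chain of a crossing. -/
def chainMatrix (k : ℕ) (near : ℕ → Bool) (j : ℕ) : Matrix (Fin 2) (Fin 2) ℤ :=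
  stepMatrix (near j) ^ k

/-- The transfer matrix of the chain of a crossing followed by the link to the next one. -/
def chainLinkMatrix (k : ℕ) (near link : ℕ → Bool) (j : ℕ) : Matrix (Fin 2) (Fin 2) ℤ :=
  chainMatrix k near j * stepMatrix (link j)

/-- The transfer matrix of the fence formed by the crossings `i`, `i + 1`, …, `i + n`. -/
def fenceMatrix (k : ℕ) (near link : ℕ → Bool) (i n : ℕ) : Matrix (Fin 2) (Fin 2) ℤ :=
  consecutiveProd (chainLinkMatrix k near link) i n * chainMatrix k near (i + n)

/-- The steps of the fence formed by the crossings `i`, `i + 1`, …. -/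
def fenceWord (k : ℕ) (near link : ℕ → Bool) (i t : ℕ) : Bool :=
  if t % (k + 1) = k then link (i + t / (k + 1)) else near (i + t / (k + 1))

theorem fenceWord_chain (k : ℕ) (near link : ℕ → Bool) (i j r : ℕ) (hr : r < k) :
    fenceWord k near link i (r + (k + 1) * j) = near (i + j) := by
  rw [fenceWord, Nat.add_mul_mod_self_left, Nat.add_mul_div_left _ _ (Nat.succ_pos k),
    Nat.mod_eq_of_lt (by omega), Nat.div_eq_of_lt (by omega), if_neg (by omega), zero_add]

theorem fenceWord_link (k : ℕ) (near link : ℕ → Bool) (i j : ℕ) :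
    fenceWord k near link i (k + (k + 1) * j) = link (i + j) := by
  rw [fenceWord, Nat.add_mul_mod_self_left, Nat.add_mul_div_left _ _ (Nat.succ_pos k),
    Nat.mod_eq_of_lt (by omega), Nat.div_eq_of_lt (by omega), if_pos rfl, zero_add]

theorem consecutiveProd_fenceWord_chain (k : ℕ) (near link : ℕ → Bool) (i j : ℕ) :
    consecutiveProd (fun t => stepMatrix (fenceWord k near link i t)) ((k + 1) * j) k =
      chainMatrix k near (i + j) := by
  refine consecutiveProd_const _ _ _ _ fun t ht => ?_
  rw [add_comm, fenceWord_chain _ _ _ _ _ _ ht]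

theorem consecutiveProd_fenceWord (k : ℕ) (near link : ℕ → Bool) (i n : ℕ) :
    consecutiveProd (fun t => stepMatrix (fenceWord k near link i t)) 0 ((k + 1) * n + k) =
      fenceMatrix k near link i n := by
  have h : consecutiveProd (fun t => stepMatrix (fenceWord k near link i t)) 0 ((k + 1) * n) =
      consecutiveProd (chainLinkMatrix k near link) i n := by
    induction n with
    | zero => rfl
    | succ n ih =>
      rw [mul_add, mul_one, ← add_assoc, consecutiveProd, consecutiveProd_add, ih, consecutiveProd,
        zero_add, zero_add, consecutiveProd_fenceWord_chain, chainLinkMatrix, mul_assoc,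
        add_comm _ k, fenceWord_link]
  rw [consecutiveProd_add, h, zero_add, consecutiveProd_fenceWord_chain, fenceMatrix]

/-- Closure under the generators suffices, so the transitive closure drops out of the count. -/
theorem mem_orderIdeals_iff (k : ℕ) (d : Pt) (I : Set (FenceElem k d)) :
    I ∈ orderIdeals k d ↔ ∀ x y, FenceStep k d x y → y ∈ I → x ∈ I := by
  constructor
  · intro h x y hxy hy
    exact h y hy x (Relation.ReflTransGen.single hxy)
  · intro h y hy x hxy
    induction hxy using Relation.ReflTransGen.head_induction_on with
    | refl => exact hy
    | head hab _ ih => exact h _ _ hab ih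

section Enumeration

variable {k N : ℕ} {d : Pt} (f : Fin (N + 1) ≃ Crossing d)

/-- The elements of the fence, numbered along the curve. -/
def fenceIndex : FenceElem k d ≃ Fin ((k + 1) * N + k + 1) :=
  ((f.symm.prodCongr (Equiv.refl _)).trans finProdFinEquiv).trans (finCongr (by ring))

theorem fenceIndex_val (j : Fin (N + 1)) (i : Fin (k + 1)) :
    (fenceIndex f (f j, i) : ℕ) = i + (k + 1) * j := by
  simp [fenceIndex]

theorem fenceIndex_symm (t : Fin ((k + 1) * N + k + 1)) (j : Fin (N + 1)) (i : Fin (k + 1))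
    (h : (t : ℕ) = i + (k + 1) * j) : (fenceIndex f).symm t = (f j, i) := by
  rw [Equiv.symm_apply_eq]
  exact Fin.ext (h.trans (fenceIndex_val f j i).symm)

variable (hlt : ∀ i j, (f i).Before (f j) ↔ i < j)
include hlt

theorem next_iff (i j : Fin (N + 1)) : (f i).Next (f j) ↔ (i : ℕ) + 1 = j := by
  constructor
  · rintro ⟨h1, h2⟩
    rw [hlt] at h1
    by_contra h
    refine h2 ⟨f ⟨i + 1, by omega⟩, ?_, ?_⟩
    · rw [hlt, Fin.lt_def]; exact Nat.lt_succ_self _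
    · rw [hlt, Fin.lt_def]; change (i : ℕ) + 1 < j; omega
  · intro h
    refine ⟨(hlt _ _).2 (by omega), ?_⟩
    rintro ⟨e, h1, h2⟩
    obtain ⟨l, rfl⟩ := f.surjective e
    rw [hlt] at h1 h2
    omega

variable (near link : ℕ → Bool) (i₀ : ℕ)
  (hnear : ∀ i : Fin (N + 1), (f i).NearRight ↔ near (i₀ + i) = true)
  (hright : ∀ i : Fin N, (f i.castSucc).right = (f i.succ).right ↔ link (i₀ + i) = true)
  (hleft : ∀ i : Fin N, (f i.castSucc).left = (f i.succ).left ↔ link (i₀ + i) = false)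
include hnear hright hleft

theorem fenceStep_of_fenceWord (t : Fin ((k + 1) * N + k)) :
    (fenceWord k near link i₀ t = true →
      FenceStep k d ((fenceIndex f).symm t.succ) ((fenceIndex f).symm t.castSucc)) ∧
    (fenceWord k near link i₀ t = false →
      FenceStep k d ((fenceIndex f).symm t.castSucc) ((fenceIndex f).symm t.succ)) := by
  obtain ⟨t, ht⟩ := t
  have hdiv := Nat.mod_add_div t (k + 1)
  have hmod := Nat.mod_lt t (Nat.succ_pos k)
  generalize t % (k + 1) = r at hdiv hmod
  generalize t / (k + 1) = j at hdiv
  subst hdiv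
  -- Position `r + (k + 1) * j` is a chain step of crossing `j` for `r < k`, and the link to
  -- crossing `j + 1` for `r = k`.
  rcases Nat.lt_succ_iff_lt_or_eq.1 hmod with hr | rfl
  · have hj : j < N + 1 := by
      by_contra hj
      have := Nat.mul_le_mul_left (k + 1) (Nat.le_of_not_lt hj)
      rw [mul_add] at this
      omega
    rw [fenceWord_chain _ _ _ _ _ _ hr,
      fenceIndex_symm f _ ⟨j, hj⟩ (Fin.succ ⟨r, hr⟩) (by simp; ring),
      fenceIndex_symm f _ ⟨j, hj⟩ (Fin.castSucc ⟨r, hr⟩) rfl]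
    refine ⟨fun h => FenceStep.chainDown _ ((hnear _).2 h) _,
      fun h => FenceStep.chainUp _ (fun h' => ?_) _⟩
    rw [(hnear _).1 h'] at h
    cases h
  · have hj : j < N := by
      by_contra hj
      have := Nat.mul_le_mul_left (r + 1) (Nat.le_of_not_lt hj)
      omega
    rw [fenceWord_link,
      fenceIndex_symm f _ (Fin.succ ⟨j, hj⟩) 0 (by simp; ring),
      fenceIndex_symm f _ (Fin.castSucc ⟨j, hj⟩) (Fin.last r) rfl]
    exact ⟨fun h => FenceStep.linkDown _ _ ((next_iff f hlt _ _).2 rfl) ((hright ⟨j, hj⟩).2 h),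
      fun h => FenceStep.linkUp _ _ ((next_iff f hlt _ _).2 rfl) ((hleft ⟨j, hj⟩).2 h)⟩

theorem exists_fenceWord_of_fenceStep (x y : FenceElem k d) (h : FenceStep k d x y) :
    ∃ t : Fin ((k + 1) * N + k),
      (fenceWord k near link i₀ t = true ∧
        x = (fenceIndex f).symm t.succ ∧ y = (fenceIndex f).symm t.castSucc) ∨
      (fenceWord k near link i₀ t = false ∧
        x = (fenceIndex f).symm t.castSucc ∧ y = (fenceIndex f).symm t.succ) := by
  have hchain : ∀ (j : Fin (N + 1)) (i : Fin k), (i : ℕ) + (k + 1) * j < (k + 1) * N + k := by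
    intro j i
    have := Nat.mul_le_mul_left (k + 1) (Nat.lt_succ_iff.1 j.2)
    omega
  have hlink : ∀ (j l : Fin (N + 1)), (j : ℕ) + 1 = l → ∃ j' : Fin N, j'.castSucc = j ∧
      j'.succ = l ∧ k + (k + 1) * (j' : ℕ) < (k + 1) * N + k := by
    intro j l hjl
    refine ⟨⟨j, by omega⟩, rfl, Fin.ext hjl, ?_⟩
    have := Nat.mul_le_mul_left (k + 1) (show (j : ℕ) + 1 ≤ N by omega)
    rw [mul_add] at this
    simp only
    omega
  cases h with
  | chainDown c hc i =>
    obtain ⟨j, rfl⟩ := f.surjective c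
    refine ⟨⟨i + (k + 1) * j, hchain j i⟩, Or.inl ⟨?_, ?_, ?_⟩⟩
    · rw [fenceWord_chain _ _ _ _ _ _ i.2, ← hnear]; exact hc
    · exact (fenceIndex_symm f _ _ _ (by simp; ring)).symm
    · exact (fenceIndex_symm f _ _ _ rfl).symm
  | chainUp c hc i =>
    obtain ⟨j, rfl⟩ := f.surjective c
    refine ⟨⟨i + (k + 1) * j, hchain j i⟩, Or.inr ⟨?_, ?_, ?_⟩⟩
    · rw [fenceWord_chain _ _ _ _ _ _ i.2, ← Bool.not_eq_true, ← hnear]; exact hc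
    · exact (fenceIndex_symm f _ _ _ rfl).symm
    · exact (fenceIndex_symm f _ _ _ (by simp; ring)).symm
  | linkDown c c' hn he =>
    obtain ⟨j, rfl⟩ := f.surjective c
    obtain ⟨l, rfl⟩ := f.surjective c'
    obtain ⟨j, rfl, rfl, hj⟩ := hlink j l ((next_iff f hlt _ _).1 hn)
    refine ⟨⟨k + (k + 1) * j, hj⟩, Or.inl ⟨?_, ?_, ?_⟩⟩
    · rw [fenceWord_link, ← hright]; exact he
    · exact (fenceIndex_symm f _ _ _ (by simp; ring)).symm
    · exact (fenceIndex_symm f _ _ _ rfl).symm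
  | linkUp c c' hn he =>
    obtain ⟨j, rfl⟩ := f.surjective c
    obtain ⟨l, rfl⟩ := f.surjective c'
    obtain ⟨j, rfl, rfl, hj⟩ := hlink j l ((next_iff f hlt _ _).1 hn)
    refine ⟨⟨k + (k + 1) * j, hj⟩, Or.inr ⟨?_, ?_, ?_⟩⟩
    · rw [fenceWord_link, ← hleft]; exact he
    · exact (fenceIndex_symm f _ _ _ rfl).symm
    · exact (fenceIndex_symm f _ _ _ (by simp; ring)).symm

/-- Numbering the elements along the curve makes the generators exactly the comparisons of `t` with
`t + 1` prescribed by `fenceWord`, so ideals correspond to admissible words. -/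
theorem ncard_orderIdeals_eq :
    ((orderIdeals k d).ncard : ℤ) = entrySum (fenceMatrix k near link i₀ N) := by
  have hinj : Function.Injective fun (I : Set (FenceElem k d)) t => (fenceIndex f).symm t ∈ I := by
    intro I J h
    ext x
    have := congrFun h (fenceIndex f x)
    simpa using this
  rw [← consecutiveProd_fenceWord, ← ncard_stepOk, ← Set.ncard_image_of_injective _ hinj]
  congr 2
  ext x
  simp only [Set.mem_image, Set.mem_ofPred_eq]
  constructor
  · rintro ⟨I, hI, rfl⟩ t
    rw [mem_orderIdeals_iff] at hI
    have := fenceStep_of_fenceWord f hlt near link i₀ hnear hright hleft t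
    cases hw : fenceWord k near link i₀ t with
    | false => exact hI _ _ (this.2 hw)
    | true => exact hI _ _ (this.1 hw)
  · intro hx
    refine ⟨{a | x (fenceIndex f a)}, ?_, by simp⟩
    rw [mem_orderIdeals_iff]
    intro a b hab hb
    obtain ⟨t, ⟨hw, rfl, rfl⟩ | ⟨hw, rfl, rfl⟩⟩ :=
      exists_fenceWord_of_fenceStep f hlt near link i₀ hnear hright hleft a b hab <;>
    · have := hx t
      rw [hw] at this
      simp only [Set.mem_ofPred_eq, Equiv.apply_symm_apply] at hb ⊢
      exact this hb

end Enumeration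

/-! ### The segments crossed by a line in the first sector -/

/-- The abscissa of the last integral point to the left of the directed line `ℝ e` on the
antidiagonal `x + y = s`. -/
def abscissa (e : Pt) (s : ℤ) : ℤ := (e.1 * s - 1) / (e.1 + e.2)

/-- The determinant of `e` and of the last integral point to the left of the directed line `ℝ e` on
the antidiagonal `x + y = s`. -/
def height (e : Pt) (s : ℤ) : ℤ := e.1 * s - (e.1 + e.2) * abscissa e s

/-- The left endpoints of the segments crossed by the directed line `ℝ e`, in their order. Those
with an even number lie on antidiagonals. -/
def edgeLeft (e : Pt) (j : ℕ) : Pt :=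
  let s : ℤ := (j / 2 : ℕ)
  let x := abscissa e s
  if j % 2 = 1 ∧ e.2 < height e s then (x + 1, s - x) else (x, s - x)

/-- The right endpoints of the segments crossed by the directed line `ℝ e`, in their order. -/
def edgeRight (e : Pt) (j : ℕ) : Pt :=
  let s : ℤ := (j / 2 : ℕ)
  let x := abscissa e s
  if j % 2 = 1 ∧ ¬ e.2 < height e s then (x + 1, s - x) else (x + 1, s - x - 1)

/-- Whether the `j`-th segment crossed by `ℝ e` is crossed closer to its right endpoint. -/
def edgeNear (e : Pt) (j : ℕ) : Bool :=
  decide (0 < det e (edgeLeft e j) + det e (edgeRight e j))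

/-- Whether the `j`-th and the next segment crossed by `ℝ e` meet to the right of the line. -/
def edgeLink (e : Pt) (j : ℕ) : Bool :=
  if j % 2 = 0 then decide (e.2 < height e (j / 2 : ℕ)) else !decide (e.2 < height e (j / 2 : ℕ))

theorem two_mul_add_one_div_two (s : ℕ) : (2 * s + 1) / 2 = s := by omega

theorem edgeLeft_even (e : Pt) (s : ℕ) :
    edgeLeft e (2 * s) = (abscissa e s, s - abscissa e s) := by
  simp [edgeLeft]

theorem edgeRight_even (e : Pt) (s : ℕ) :
    edgeRight e (2 * s) = (abscissa e s + 1, s - abscissa e s - 1) := by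
  simp [edgeRight]

theorem edgeLeft_odd_of_lt (e : Pt) (s : ℕ) (h : e.2 < height e s) :
    edgeLeft e (2 * s + 1) = (abscissa e s + 1, s - abscissa e s) := by
  simp [edgeLeft, two_mul_add_one_div_two, h, Nat.add_mod]

theorem edgeRight_odd_of_lt (e : Pt) (s : ℕ) (h : e.2 < height e s) :
    edgeRight e (2 * s + 1) = (abscissa e s + 1, s - abscissa e s - 1) := by
  simp [edgeRight, two_mul_add_one_div_two, h]

theorem edgeLeft_odd_of_le (e : Pt) (s : ℕ) (h : ¬ e.2 < height e s) :
    edgeLeft e (2 * s + 1) = (abscissa e s, s - abscissa e s) := by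
  simp [edgeLeft, two_mul_add_one_div_two, h]

theorem edgeRight_odd_of_le (e : Pt) (s : ℕ) (h : ¬ e.2 < height e s) :
    edgeRight e (2 * s + 1) = (abscissa e s + 1, s - abscissa e s) := by
  simp [edgeRight, two_mul_add_one_div_two, h, Nat.add_mod]

theorem edgeLink_even (e : Pt) (s : ℕ) :
    edgeLink e (2 * s) = decide (e.2 < height e s) := by
  simp [edgeLink]

theorem edgeLink_odd (e : Pt) (s : ℕ) :
    edgeLink e (2 * s + 1) = !decide (e.2 < height e s) := by
  simp [edgeLink, two_mul_add_one_div_two, Nat.add_mod]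

section FirstSector

variable {e : Pt} (h1 : 0 < e.1) (h2 : 0 ≤ e.2)
include h1 h2

/-- The `- 1` in `abscissa` puts heights into `1, …, e.1 + e.2` instead of starting at `0`: an
integral point on the line counts as right of the curve, as the left deformation demands. -/
theorem height_pos (s : ℤ) : 0 < height e s := by
  have := Int.mul_ediv_add_emod (e.1 * s - 1) (e.1 + e.2)
  have := Int.emod_nonneg (e.1 * s - 1) (show e.1 + e.2 ≠ 0 by omega)
  unfold height abscissa
  linarith

theorem height_le (s : ℤ) : height e s ≤ e.1 + e.2 := by
  have := Int.mul_ediv_add_emod (e.1 * s - 1) (e.1 + e.2)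
  have := Int.emod_lt_of_pos (e.1 * s - 1) (show 0 < e.1 + e.2 by omega)
  unfold height abscissa
  linarith

/-- Uniqueness of division with remainder; later values of `abscissa` are computed through this. -/
theorem abscissa_eq (s x : ℤ) (hx : 0 < e.1 * s - (e.1 + e.2) * x)
    (hx' : e.1 * s - (e.1 + e.2) * x ≤ e.1 + e.2) : abscissa e s = x := by
  have := height_pos h1 h2 s
  have := height_le h1 h2 s
  unfold height at *
  have hS : 0 < e.1 + e.2 := by omega
  apply le_antisymm
  · by_contra! h
    nlinarith [mul_le_mul_of_nonneg_left (Int.add_one_le_iff.2 h) hS.le]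
  · by_contra! h
    nlinarith [mul_le_mul_of_nonneg_left (Int.add_one_le_iff.2 h) hS.le]

/-- With `x = abscissa e s`, the point `(x + 1, s - x)` of the next antidiagonal has determinant
`height e s - e.2`, so the sign of this number decides on which side it lies. -/
theorem abscissa_succ_of_lt (s : ℤ) (h : e.2 < height e s) :
    abscissa e (s + 1) = abscissa e s + 1 := by
  have := height_le h1 h2 s
  unfold height at *
  apply abscissa_eq h1 h2 <;> linarith

theorem abscissa_succ_of_le (s : ℤ) (h : ¬ e.2 < height e s) :
    abscissa e (s + 1) = abscissa e s := by
  have := height_pos h1 h2 s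
  unfold height at *
  apply abscissa_eq h1 h2 <;> linarith

theorem height_succ_of_lt (s : ℤ) (h : e.2 < height e s) :
    height e (s + 1) = height e s - e.2 := by
  rw [height, abscissa_succ_of_lt h1 h2 s h, height]
  ring

theorem height_succ_of_le (s : ℤ) (h : ¬ e.2 < height e s) :
    height e (s + 1) = height e s + e.1 := by
  rw [height, abscissa_succ_of_le h1 h2 s h, height]
  ring

omit h1 h2 in
theorem isSegment_edge (j : ℕ) : IsSegment (edgeLeft e j) (edgeRight e j) := by
  obtain ⟨s, rfl | rfl⟩ := Nat.even_or_odd' j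
  · rw [edgeLeft_even, edgeRight_even]
    simp [IsSegment]
  · by_cases h : e.2 < height e s
    · rw [edgeLeft_odd_of_lt _ _ h, edgeRight_odd_of_lt _ _ h]
      simp [IsSegment]
    · rw [edgeLeft_odd_of_le _ _ h, edgeRight_odd_of_le _ _ h]
      simp [IsSegment]

omit h1 h2 in
theorem det_edge_even (s : ℕ) : det e (edgeLeft e (2 * s)) = height e s ∧
    det e (edgeRight e (2 * s)) = height e s - (e.1 + e.2) := by
  rw [edgeLeft_even, edgeRight_even]
  constructor <;> simp only [det, height] <;> ring

omit h1 h2 in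
theorem det_edge_odd_of_lt (s : ℕ) (h : e.2 < height e s) :
    det e (edgeLeft e (2 * s + 1)) = height e s - e.2 ∧
      det e (edgeRight e (2 * s + 1)) = height e s - (e.1 + e.2) := by
  rw [edgeLeft_odd_of_lt _ _ h, edgeRight_odd_of_lt _ _ h]
  constructor <;> simp only [det, height] <;> ring

omit h1 h2 in
theorem det_edge_odd_of_le (s : ℕ) (h : ¬ e.2 < height e s) :
    det e (edgeLeft e (2 * s + 1)) = height e s ∧
      det e (edgeRight e (2 * s + 1)) = height e s - e.2 := by
  rw [edgeLeft_odd_of_le _ _ h, edgeRight_odd_of_le _ _ h]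
  constructor <;> simp only [det, height] <;> ring

theorem det_edgeLeft_pos (j : ℕ) : 0 < det e (edgeLeft e j) := by
  obtain ⟨s, rfl | rfl⟩ := Nat.even_or_odd' j
  · rw [(det_edge_even s).1]
    exact height_pos h1 h2 s
  · by_cases h : e.2 < height e s
    · rw [(det_edge_odd_of_lt s h).1]; omega
    · rw [(det_edge_odd_of_le s h).1]
      exact height_pos h1 h2 s

theorem det_edgeRight_nonpos (j : ℕ) : det e (edgeRight e j) ≤ 0 := by
  have := height_le h1 h2
  obtain ⟨s, rfl | rfl⟩ := Nat.even_or_odd' j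
  · rw [(det_edge_even s).2]
    linarith [this s]
  · by_cases h : e.2 < height e s
    · rw [(det_edge_odd_of_lt s h).2]
      linarith [this s]
    · rw [(det_edge_odd_of_le s h).2]; omega

theorem time_edge_even (s : ℕ) :
    time e (edgeLeft e (2 * s)) (edgeRight e (2 * s)) = s / (e.1 + e.2) := by
  have hS : (0 : ℚ) < e.1 + e.2 := by exact_mod_cast (show 0 < e.1 + e.2 by omega)
  have hd := det_edge_even (e := e) s
  have hS' : ((height e s - (e.1 + e.2) - height e s : ℤ) : ℚ) ≠ 0 := by
    rw [sub_sub_cancel_left]; push_cast; linarith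
  rw [time, hd.1, hd.2, div_eq_div_iff hS' hS.ne', edgeLeft_even, edgeRight_even]
  simp only [det]
  push_cast
  ring

omit h2 in
theorem time_edge_odd_of_lt (s : ℕ) (h : e.2 < height e s) :
    time e (edgeLeft e (2 * s + 1)) (edgeRight e (2 * s + 1)) = (abscissa e s + 1) / e.1 := by
  have hS : (0 : ℚ) < e.1 := by exact_mod_cast h1
  have hd := det_edge_odd_of_lt s h
  have hS' : ((height e s - (e.1 + e.2) - (height e s - e.2) : ℤ) : ℚ) ≠ 0 := by
    push_cast; linarith
  rw [time, hd.1, hd.2, div_eq_div_iff hS' hS.ne', edgeLeft_odd_of_lt _ _ h,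
    edgeRight_odd_of_lt _ _ h]
  simp only [det]
  push_cast
  ring

theorem time_edge_odd_of_le (s : ℕ) (h : ¬ e.2 < height e s) :
    time e (edgeLeft e (2 * s + 1)) (edgeRight e (2 * s + 1)) = (s - abscissa e s) / e.2 := by
  have hS : (0 : ℚ) < e.2 := by
    have := height_pos h1 h2 s
    exact_mod_cast (show 0 < e.2 by omega)
  have hd := det_edge_odd_of_le s h
  have hS' : ((height e s - e.2 - height e s : ℤ) : ℚ) ≠ 0 := by
    push_cast; linarith
  rw [time, hd.1, hd.2, div_eq_div_iff hS' hS.ne', edgeLeft_odd_of_le _ _ h,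
    edgeRight_odd_of_le _ _ h]
  simp only [det]
  push_cast
  ring

/-- Edge `2 * s + 1` lies in the strip between the antidiagonals `s` and `s + 1`. It meets the line
on the boundary of the strip only at a right endpoint that is an integral point of the line. -/
theorem le_time_edge_odd (s : ℕ) :
    (s : ℚ) / (e.1 + e.2) ≤ time e (edgeLeft e (2 * s + 1)) (edgeRight e (2 * s + 1)) ∧
    ((s : ℚ) / (e.1 + e.2) = time e (edgeLeft e (2 * s + 1)) (edgeRight e (2 * s + 1)) ↔
      height e s = e.1 + e.2) := by
  have hP : (0 : ℚ) < e.1 := by exact_mod_cast h1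
  have hS : (0 : ℚ) < e.1 + e.2 := by exact_mod_cast (show 0 < e.1 + e.2 by omega)
  have hle := height_le h1 h2 s
  have hpos := height_pos h1 h2 s
  by_cases h : e.2 < height e s
  · rw [time_edge_odd_of_lt h1 s h, div_le_div_iff₀ hS hP, div_eq_div_iff hS.ne' hP.ne']
    norm_cast
    unfold height at *
    constructor
    · linarith
    · constructor <;> intro _ <;> linarith
  · have hQ : (0 : ℚ) < e.2 := by exact_mod_cast (show 0 < e.2 by omega)
    rw [time_edge_odd_of_le h1 h2 s h, div_le_div_iff₀ hS hQ, div_eq_div_iff hS.ne' hQ.ne']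
    norm_cast
    unfold height at *
    constructor
    · linarith
    · constructor <;> intro _ <;> linarith

theorem time_edge_odd_le (s : ℕ) :
    time e (edgeLeft e (2 * s + 1)) (edgeRight e (2 * s + 1)) ≤ ((s : ℚ) + 1) / (e.1 + e.2) ∧
    (time e (edgeLeft e (2 * s + 1)) (edgeRight e (2 * s + 1)) = ((s : ℚ) + 1) / (e.1 + e.2) ↔
      height e s = e.2) := by
  have hP : (0 : ℚ) < e.1 := by exact_mod_cast h1
  have hS : (0 : ℚ) < e.1 + e.2 := by exact_mod_cast (show 0 < e.1 + e.2 by omega)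
  have hle := height_le h1 h2 s
  have hpos := height_pos h1 h2 s
  by_cases h : e.2 < height e s
  · rw [time_edge_odd_of_lt h1 s h, div_le_div_iff₀ hP hS, div_eq_div_iff hP.ne' hS.ne']
    norm_cast
    push_cast
    unfold height at *
    constructor
    · linarith
    · constructor <;> intro _ <;> linarith
  · have hQ : (0 : ℚ) < e.2 := by exact_mod_cast (show 0 < e.2 by omega)
    rw [time_edge_odd_of_le h1 h2 s h, div_le_div_iff₀ hQ hS, div_eq_div_iff hQ.ne' hS.ne']
    norm_cast
    push_cast
    unfold height at *
    constructor
    · linarith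
    · constructor <;> intro _ <;> linarith

/-- The segments crossed by `ℝ e` are numbered in the order in which the curve crosses them. -/
theorem edge_before (i j : ℕ) (hij : i < j) :
    time e (edgeLeft e i) (edgeRight e i) < time e (edgeLeft e j) (edgeRight e j) ∨
    (time e (edgeLeft e i) (edgeRight e i) = time e (edgeLeft e j) (edgeRight e j) ∧
      0 < det (edgeLeft e j - edgeRight e j) (edgeLeft e i - edgeRight e i)) := by
  have hS : (0 : ℚ) < e.1 + e.2 := by exact_mod_cast (show 0 < e.1 + e.2 by omega)
  have hmono : ∀ a b : ℕ, a ≤ b → (a : ℚ) / (e.1 + e.2) ≤ b / (e.1 + e.2) := by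
    intro a b hab
    gcongr
  have hmono' : ∀ a b : ℕ, a < b → (a : ℚ) / (e.1 + e.2) < b / (e.1 + e.2) := by
    intro a b hab
    gcongr
  obtain ⟨s, hs⟩ := Nat.even_or_odd' i
  obtain ⟨t, ht⟩ := Nat.even_or_odd' j
  have hs1 := le_time_edge_odd h1 h2 s
  have hs2 := time_edge_odd_le h1 h2 s
  have ht1 := le_time_edge_odd h1 h2 t
  have ht2 := time_edge_odd_le h1 h2 t
  -- Times can tie only at an integral point of the line; there the edges `2 * s - 1`, `2 * s`, `2 *
  -- s + 1` are horizontal, antidiagonal and vertical, and the clockwise tie-break takes them in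
  -- this order.
  rcases hs with rfl | rfl <;> rcases ht with rfl | rfl
  · left
    rw [time_edge_even h1 h2, time_edge_even h1 h2]
    exact hmono' s t (by omega)
  · rw [time_edge_even h1 h2]
    rcases (show s ≤ t by omega).lt_or_eq with hst | rfl
    · left
      exact (hmono' s t hst).trans_le ht1.1
    · rcases hs1.1.lt_or_eq with hlt | heq
      · exact Or.inl hlt
      · refine Or.inr ⟨heq, ?_⟩
        have hh : e.2 < height e s := by rw [hs1.2.1 heq]; omega
        rw [edgeLeft_odd_of_lt _ _ hh, edgeRight_odd_of_lt _ _ hh, edgeLeft_even, edgeRight_even]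
        simp [det]
  · rw [time_edge_even h1 h2]
    have hst := hmono (s + 1) t (by omega)
    push_cast at hst
    rcases (hs2.1.trans hst).lt_or_eq with hlt | heq
    · exact Or.inl hlt
    · refine Or.inr ⟨heq, ?_⟩
      have hh : ¬ e.2 < height e s := by
        rw [hs2.2.1 (le_antisymm hs2.1 (heq ▸ hst))]; omega
      rw [edgeLeft_odd_of_le _ _ hh, edgeRight_odd_of_le _ _ hh, edgeLeft_even, edgeRight_even]
      simp [det]
  · have hst := hmono (s + 1) t (by omega)
    push_cast at hst
    rcases (hs2.1.trans (hst.trans ht1.1)).lt_or_eq with hlt | heq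
    · exact Or.inl hlt
    · refine Or.inr ⟨heq, ?_⟩
      have hh : ¬ e.2 < height e s := by
        rw [hs2.2.1 (le_antisymm hs2.1 (heq ▸ hst.trans ht1.1))]; omega
      have hh' : e.2 < height e t := by
        rw [ht1.2.1 (le_antisymm ht1.1 (heq ▸ hs2.1.trans hst))]; omega
      rw [edgeLeft_odd_of_le _ _ hh, edgeRight_odd_of_le _ _ hh, edgeLeft_odd_of_lt _ _ hh',
        edgeRight_odd_of_lt _ _ hh']
      simp [det]

/-- Passing from left to right decreases `det e`, which leaves only the directions `(1, 0)`, `(0,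
-1)` and `(1, -1)`. Positive time makes the antidiagonal index nonnegative, hence a natural number.
-/
theorem edge_eq_of_isSegment (a b : Pt) (hab : IsSegment a b) (ha : 0 < det e a)
    (hb : det e b ≤ 0) (ht : 0 < time e a b) : ∃ j, edgeLeft e j = a ∧ edgeRight e j = b := by
  have hdiff : (det e b - det e a : ℤ) < 0 := by omega
  have hdiff' : ((det e b - det e a : ℤ) : ℚ) < 0 := by exact_mod_cast hdiff
  have hneg : det a b < 0 := by
    by_contra! h
    exact absurd ht (not_lt.2 (div_nonpos_of_nonneg_of_nonpos (by exact_mod_cast h) hdiff'.le))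
  obtain ⟨x, y⟩ := a
  obtain ⟨x', y'⟩ := b
  simp only [IsSegment, Prod.mk_sub_mk, Prod.mk.injEq] at hab
  simp only [det] at ha hb hneg
  rcases hab with ⟨hx, hy⟩ | ⟨hx, hy⟩ | ⟨hx, hy⟩ | ⟨hx, hy⟩ | ⟨hx, hy⟩ | ⟨hx, hy⟩
  · obtain rfl : x' = x + 1 := by omega
    obtain rfl : y' = y := by omega
    have hy0 : 0 < y' := by linarith
    have hx0 : 0 ≤ x := by nlinarith
    obtain ⟨s, hs⟩ := Int.eq_ofNat_of_zero_le (show 0 ≤ x + y' by omega)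
    have hxs : abscissa e s = x := by
      apply abscissa_eq h1 h2 <;> rw [← hs] <;> linarith
    have hh : ¬ e.2 < height e s := by
      rw [height, hxs, ← hs]; linarith
    refine ⟨2 * s + 1, ?_⟩
    rw [edgeLeft_odd_of_le _ _ hh, edgeRight_odd_of_le _ _ hh, hxs, ← hs]
    simp
  · obtain rfl : x' = x - 1 := by omega
    obtain rfl : y' = y := by omega
    nlinarith
  · obtain rfl : x' = x := by omega
    obtain rfl : y' = y + 1 := by omega
    nlinarith
  · obtain rfl : x' = x := by omega
    obtain rfl : y' = y - 1 := by omega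
    have hx0 : 0 < x' := by linarith
    have hy0 : 0 < y := by nlinarith
    obtain ⟨s, hs⟩ := Int.eq_ofNat_of_zero_le (show 0 ≤ x' + y - 1 by omega)
    have hxs : abscissa e s = x' - 1 := by
      apply abscissa_eq h1 h2 <;> rw [← hs] <;> linarith
    have hh : e.2 < height e s := by
      rw [height, hxs, ← hs]; linarith
    refine ⟨2 * s + 1, ?_⟩
    rw [edgeLeft_odd_of_lt _ _ hh, edgeRight_odd_of_lt _ _ hh, hxs, ← hs]
    simp
  · obtain rfl : x' = x + 1 := by omega
    obtain rfl : y' = y - 1 := by omega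
    obtain ⟨s, hs⟩ := Int.eq_ofNat_of_zero_le (show 0 ≤ x + y by linarith)
    have hxs : abscissa e s = x := by
      apply abscissa_eq h1 h2 <;> rw [← hs] <;> linarith
    refine ⟨2 * s, ?_⟩
    rw [edgeLeft_even, edgeRight_even, hxs, ← hs]
    simp
  · obtain rfl : x' = x - 1 := by omega
    obtain rfl : y' = y + 1 := by omega
    nlinarith

/-- Edges `0` and `1` have the origin as right endpoint and are met at time `0`. -/
theorem time_edge_pos_iff (j : ℕ) : 0 < time e (edgeLeft e j) (edgeRight e j) ↔ 2 ≤ j := by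
  have hS : (0 : ℚ) < e.1 + e.2 := by exact_mod_cast (show 0 < e.1 + e.2 by omega)
  constructor
  · contrapose!
    intro hj
    interval_cases j
    · rw [time_edge_even h1 h2 0]; simp
    · have := (le_time_edge_odd h1 h2 0).2.2 (by
        rw [height, abscissa_eq h1 h2 _ (-1)] <;> simp <;> omega)
      rw [mul_zero, zero_add] at this
      rw [← this]
      simp
  · intro hj
    obtain ⟨s, rfl | rfl⟩ := Nat.even_or_odd' j
    · rw [time_edge_even h1 h2]
      have : 0 < s := by omega
      positivity
    · have : 0 < s := by omega
      exact (show (0 : ℚ) < s / (e.1 + e.2) by positivity).trans_le (le_time_edge_odd h1 h2 s).1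

/-- With `S = e.1 + e.2`, the edges around the endpoint start at `2 * S - 1` if `0 < e.2`. If `e.2 =
0`, the line runs along horizontal segments, and edge `2 * S - 1` still belongs to the preceding
integral point of the line. -/
theorem time_edge_lt_one_iff (j : ℕ) : time e (edgeLeft e j) (edgeRight e j) < 1 ↔
    (j : ℤ) < if e.2 = 0 then 2 * e.1 else 2 * (e.1 + e.2) - 1 := by
  have hS : (0 : ℚ) < e.1 + e.2 := by exact_mod_cast (show 0 < e.1 + e.2 by omega)
  obtain ⟨s, rfl | rfl⟩ := Nat.even_or_odd' j
  · rw [time_edge_even h1 h2, div_lt_one hS]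
    norm_cast
    split_ifs <;> omega
  · have hl := le_time_edge_odd h1 h2 s
    have hr := time_edge_odd_le h1 h2 s
    rcases lt_trichotomy ((s : ℤ) + 1) (e.1 + e.2) with h | h | h
    · refine iff_of_true (hr.1.trans_lt ?_) (by split_ifs <;> omega)
      rw [div_lt_one hS]
      exact_mod_cast h
    · have hQ : (((s : ℚ) + 1) / (e.1 + e.2)) = 1 := by
        rw [div_eq_one_iff_eq hS.ne']
        exact_mod_cast h
      rw [hQ] at hr
      rw [lt_iff_le_and_ne, and_iff_right hr.1, Ne, hr.2]
      have hs : (s : ℤ) = e.1 + e.2 - 1 := by omega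
      split_ifs with h0
      · have := height_pos h1 h2 s
        refine iff_of_true (by omega) (by push_cast; omega)
      · refine iff_of_false (not_not.2 ?_) (by push_cast; omega)
        rw [height, abscissa_eq h1 h2 _ (e.1 - 1)] <;> rw [hs] <;> ring_nf <;> omega
    · refine iff_of_false (not_lt.2 (le_trans ?_ hl.1)) (by split_ifs <;> omega)
      rw [one_le_div hS]
      exact_mod_cast (show e.1 + e.2 ≤ s by omega)

theorem edge_link (j : ℕ) :
    (edgeRight e j = edgeRight e (j + 1) ↔ edgeLink e j = true) ∧
    (edgeLeft e j = edgeLeft e (j + 1) ↔ edgeLink e j = false) := by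
  obtain ⟨s, rfl | rfl⟩ := Nat.even_or_odd' j
  · rw [edgeLink_even, edgeLeft_even, edgeRight_even]
    by_cases h : e.2 < height e s
    · rw [edgeLeft_odd_of_lt _ _ h, edgeRight_odd_of_lt _ _ h]
      simp [h]
    · rw [edgeLeft_odd_of_le _ _ h, edgeRight_odd_of_le _ _ h]
      simp [h]
  · rw [edgeLink_odd, show 2 * s + 1 + 1 = 2 * (s + 1) by ring, edgeLeft_even, edgeRight_even]
    push_cast
    by_cases h : e.2 < height e s
    · rw [edgeLeft_odd_of_lt _ _ h, edgeRight_odd_of_lt _ _ h, abscissa_succ_of_lt h1 h2 _ h]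
      simp [h]
    · rw [edgeLeft_odd_of_le _ _ h, edgeRight_odd_of_le _ _ h, abscissa_succ_of_le h1 h2 _ h]
      simp [h]
      ring

theorem edge_nearRight (j : ℕ) :
    1 / 2 < fraction e (edgeLeft e j) (edgeRight e j) ↔ edgeNear e j = true := by
  have hl := det_edgeLeft_pos h1 h2 j
  have hr := det_edgeRight_nonpos h1 h2 j
  have hd : (0 : ℚ) < ((det e (edgeLeft e j) - det e (edgeRight e j) : ℤ) : ℚ) := by
    exact_mod_cast (show 0 < det e (edgeLeft e j) - det e (edgeRight e j) by omega)
  rw [fraction, div_lt_div_iff₀ two_pos hd, edgeNear, decide_eq_true_iff]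
  norm_cast
  omega

end FirstSector

/-! ### Reduction to the first sector by lattice rotations -/

/-- An additive automorphism of the integral points that preserves orientation, area and the
segments of the lattice. -/
def IsLatticeRotation (ρ : Pt ≃+ Pt) : Prop :=
  (∀ u v, det (ρ u) (ρ v) = det u v) ∧ ∀ a b, IsSegment (ρ a) (ρ b) ↔ IsSegment a b

/-- The automorphism of order six which permutes the six directions of segments cyclically. -/
def sixthTurn : Pt ≃+ Pt where
  toFun v := (-v.2, v.1 + v.2)
  invFun v := (v.1 + v.2, -v.1)
  left_inv v := by ext <;> simp
  right_inv v := by ext <;> simp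
  map_add' u v := by ext <;> simp <;> ring

theorem isLatticeRotation_refl : IsLatticeRotation (AddEquiv.refl Pt) :=
  ⟨fun _ _ => rfl, fun _ _ => Iff.rfl⟩

theorem isLatticeRotation_sixthTurn : IsLatticeRotation sixthTurn := by
  constructor
  · intro u v
    simp only [det, sixthTurn, AddEquiv.coe_mk, Equiv.coe_fn_mk]
    ring
  · intro a b
    simp only [IsSegment, sixthTurn, AddEquiv.coe_mk, Equiv.coe_fn_mk, Prod.ext_iff, Prod.fst_sub,
      Prod.snd_sub]
    omega

theorem IsLatticeRotation.trans {ρ ρ' : Pt ≃+ Pt} (h : IsLatticeRotation ρ)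
    (h' : IsLatticeRotation ρ') : IsLatticeRotation (ρ.trans ρ') :=
  ⟨fun u v => (h'.1 _ _).trans (h.1 u v), fun a b => (h'.2 _ _).trans (h.2 a b)⟩

/-- The images of the sector `0 < x`, `0 ≤ y` under lattice rotations cover the plane without the
origin. -/
theorem exists_isLatticeRotation (d : Pt) (hd : d ≠ 0) :
    ∃ ρ e, IsLatticeRotation ρ ∧ ρ e = d ∧ 0 < e.1 ∧ 0 ≤ e.2 := by
  have r1 := isLatticeRotation_sixthTurn
  have r2 := r1.trans r1
  have r3 := r2.trans r1
  have r4 := r3.trans r1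
  have r5 := r4.trans r1
  obtain ⟨p, q⟩ := d
  have hpq : p ≠ 0 ∨ q ≠ 0 := by
    by_contra! h
    exact hd (Prod.ext h.1 h.2)
  by_cases c1 : 0 < p ∧ 0 ≤ q
  · exact ⟨_, (p, q), isLatticeRotation_refl, rfl, c1.1, c1.2⟩
  by_cases c2 : p ≤ 0 ∧ 0 < p + q
  · exact ⟨_, (p + q, -p), r1, by simp [sixthTurn], by simp only; omega, by simp only; omega⟩
  by_cases c3 : 0 < q ∧ p + q ≤ 0
  · exact ⟨_, (q, -(p + q)), r2, by simp [sixthTurn], by simp only; omega, by simp only; omega⟩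
  by_cases c4 : p < 0 ∧ q ≤ 0
  · exact ⟨_, (-p, -q), r3, by simp [sixthTurn], by simp only; omega, by simp only; omega⟩
  by_cases c5 : 0 ≤ p ∧ p + q < 0
  · exact ⟨_, (-(p + q), p), r4, by simp [sixthTurn], by simp only; omega, by simp only; omega⟩
  · exact ⟨_, (-q, p + q), r5, by simp [sixthTurn], by simp only; omega, by simp only; omega⟩

theorem IsLatticeRotation.time {ρ : Pt ≃+ Pt} (h : IsLatticeRotation ρ) (d a b : Pt) :
    time (ρ d) (ρ a) (ρ b) = time d a b := by
  simp only [KMarkov.time, h.1]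

theorem IsLatticeRotation.fraction {ρ : Pt ≃+ Pt} (h : IsLatticeRotation ρ) (d a b : Pt) :
    fraction (ρ d) (ρ a) (ρ b) = fraction d a b := by
  simp only [KMarkov.fraction, h.1]

theorem Crossing.ext_endpoints {d : Pt} {c c' : Crossing d} (hl : c.left = c'.left)
    (hr : c.right = c'.right) : c = c' := by
  cases c
  cases c'
  cases hl
  cases hr
  rfl

theorem Crossing.Before.irrefl {d : Pt} (c : Crossing d) : ¬ c.Before c := by
  rintro (h | ⟨-, h⟩)
  · exact lt_irrefl _ h
  · simp [det, mul_comm] at h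

theorem Crossing.Before.asymm {d : Pt} {c c' : Crossing d} (h : c.Before c') :
    ¬ c'.Before c := by
  have hdet : ∀ u v : Pt, det u v = -det v u := fun u v => by simp only [det]; ring
  rintro (h' | ⟨h', g'⟩) <;> rcases h with h | ⟨h, g⟩
  · exact lt_asymm h h'
  · exact h'.ne h.symm
  · exact h.ne h'.symm
  · rw [hdet] at g
    omega

/-! ### Crossings as numbered edges -/

section FirstSector

variable {ρ : Pt ≃+ Pt} (hρ : IsLatticeRotation ρ) {e : Pt} (h1 : 0 < e.1) (h2 : 0 ≤ e.2)

/-- The crossings of the curve in direction `ρ e`, where `e` lies in the first sector. -/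
def edgeCrossing (j : ℕ)
    (hj : 2 ≤ j ∧ (j : ℤ) < if e.2 = 0 then 2 * e.1 else 2 * (e.1 + e.2) - 1) :
    Crossing (ρ e) where
  left := ρ (edgeLeft e j)
  right := ρ (edgeRight e j)
  isSegment := (hρ.2 _ _).2 (isSegment_edge j)
  left_pos := by rw [hρ.1]; exact det_edgeLeft_pos h1 h2 j
  right_nonpos := by rw [hρ.1]; exact det_edgeRight_nonpos h1 h2 j
  time_pos := by rw [hρ.time, time_edge_pos_iff h1 h2]; exact hj.1
  time_lt_one := by rw [hρ.time, time_edge_lt_one_iff h1 h2]; exact hj.2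

theorem exists_edgeCrossing (c : Crossing (ρ e)) :
    ∃ j hj, edgeCrossing hρ h1 h2 j hj = c := by
  obtain ⟨l, hl⟩ := ρ.surjective c.left
  obtain ⟨r, hr⟩ := ρ.surjective c.right
  have g1 := c.isSegment
  have g2 := c.left_pos
  have g3 := c.right_nonpos
  have g4 := c.time_pos
  have g5 := c.time_lt_one
  rw [← hl, ← hr] at g1 g4 g5
  rw [← hl, hρ.1] at g2
  rw [← hr, hρ.1] at g3
  rw [hρ.2] at g1
  rw [hρ.time] at g4 g5
  obtain ⟨j, rfl, rfl⟩ := edge_eq_of_isSegment h1 h2 l r g1 g2 g3 g4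
  refine ⟨j, ⟨(time_edge_pos_iff h1 h2 j).1 g4, (time_edge_lt_one_iff h1 h2 j).1 g5⟩, ?_⟩
  exact Crossing.ext_endpoints hl hr

theorem edgeCrossing_before_iff (i j : ℕ) (hi hj) :
    (edgeCrossing hρ h1 h2 i hi).Before (edgeCrossing hρ h1 h2 j hj) ↔ i < j := by
  have key : ∀ i j hi hj, i < j →
      (edgeCrossing hρ h1 h2 i hi).Before (edgeCrossing hρ h1 h2 j hj) := by
    intro i j hi hj hij
    unfold Crossing.Before
    simp only [edgeCrossing, hρ.time, ← map_sub, hρ.1]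
    exact edge_before h1 h2 i j hij
  refine ⟨fun h => ?_, key i j hi hj⟩
  rcases lt_trichotomy i j with hij | rfl | hij
  · exact hij
  · exact absurd h (Crossing.Before.irrefl _)
  · exact absurd h (key j i hj hi hij).asymm

include hρ h1 h2

/-- The crossed edges have the numbers `2, …, N + 2`; hence the offset `2` and the bound `N + 3`. -/
theorem ncard_orderIdeals_edge (k N : ℕ)
    (hN : (N : ℤ) + 3 = if e.2 = 0 then 2 * e.1 else 2 * (e.1 + e.2) - 1) :
    ((orderIdeals k (ρ e)).ncard : ℤ) =
      entrySum (fenceMatrix k (edgeNear e) (edgeLink e) 2 N) := by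
  have hj : ∀ i : Fin (N + 1), 2 ≤ 2 + (i : ℕ) ∧ ((2 + (i : ℕ) : ℕ) : ℤ) <
      if e.2 = 0 then 2 * e.1 else 2 * (e.1 + e.2) - 1 := by
    intro i
    rw [← hN]
    have := i.2
    push_cast
    omega
  have hbij : Function.Bijective fun i : Fin (N + 1) =>
      edgeCrossing hρ h1 h2 (2 + i) (hj i) := by
    constructor
    · intro i i' h
      have hirr := fun x => Crossing.Before.irrefl x (d := ρ e)
      simp only at h
      have a1 := edgeCrossing_before_iff hρ h1 h2 (2 + i) (2 + i') (hj i) (hj i')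
      have a2 := edgeCrossing_before_iff hρ h1 h2 (2 + i') (2 + i) (hj i') (hj i)
      rw [h] at a1 a2
      simp only [hirr, false_iff] at a1 a2
      omega
    · intro c
      obtain ⟨j, hj', rfl⟩ := exists_edgeCrossing hρ h1 h2 c
      have hlt := hj'.2
      rw [← hN] at hlt
      obtain ⟨i, rfl⟩ := Nat.exists_eq_add_of_le hj'.1
      exact ⟨⟨i, by push_cast at hlt; omega⟩, rfl⟩
  refine ncard_orderIdeals_eq (Equiv.ofBijective _ hbij) ?_ _ _ 2 ?_ ?_ ?_
  · intro i j
    simp only [Equiv.ofBijective_apply, edgeCrossing_before_iff]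
    omega
  · intro i
    simp only [Equiv.ofBijective_apply, Crossing.NearRight, edgeCrossing, hρ.fraction]
    exact edge_nearRight h1 h2 _
  · intro i
    simp only [Equiv.ofBijective_apply, edgeCrossing, EmbeddingLike.apply_eq_iff_eq]
    exact (edge_link h1 h2 (2 + i)).1
  · intro i
    simp only [Equiv.ofBijective_apply, edgeCrossing, EmbeddingLike.apply_eq_iff_eq]
    exact (edge_link h1 h2 (2 + i)).2

/-- There is no crossing, so the number `N` of the general count would be `-1`. -/
theorem ncard_orderIdeals_of_eq_one (k : ℕ) (hP : e.1 = 1) (hQ : e.2 = 0) :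
    (orderIdeals k (ρ e)).ncard = 1 := by
  have : IsEmpty (Crossing (ρ e)) := by
    refine ⟨fun c => ?_⟩
    obtain ⟨j, hj, -⟩ := exists_edgeCrossing hρ h1 h2 c
    rw [if_pos hQ, hP] at hj
    omega
  rw [Set.ncard_eq_one]
  refine ⟨∅, Set.eq_singleton_iff_unique_mem.2 ⟨?_, fun I _ => ?_⟩⟩
  · intro x
    exact isEmptyElim x
  · ext x
    exact isEmptyElim x

theorem finite_crossing : Finite (Crossing (ρ e)) := by
  have : Finite {j : ℕ // 2 ≤ j ∧ (j : ℤ) < if e.2 = 0 then 2 * e.1 else 2 * (e.1 + e.2) - 1} := by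
    refine Set.Finite.to_subtype (Set.Finite.subset
      (Set.finite_lt_nat (if e.2 = 0 then 2 * e.1 else 2 * (e.1 + e.2) - 1).toNat) fun j hj => ?_)
    exact Int.lt_toNat.2 hj.2
  refine Finite.of_surjective (fun j : {j : ℕ // 2 ≤ j ∧
    (j : ℤ) < if e.2 = 0 then 2 * e.1 else 2 * (e.1 + e.2) - 1} =>
      edgeCrossing hρ h1 h2 j.1 j.2) fun c => ?_
  obtain ⟨j, hj, h⟩ := exists_edgeCrossing hρ h1 h2 c
  exact ⟨⟨j, hj⟩, h⟩

end FirstSector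

theorem ncard_orderIdeals_pos (k : ℕ) (d : Pt) (hd : d ≠ 0) : 0 < (orderIdeals k d).ncard := by
  obtain ⟨ρ, e, hρ, rfl, h1, h2⟩ := exists_isLatticeRotation d hd
  have := finite_crossing hρ h1 h2
  rw [Set.ncard_pos (Set.toFinite _)]
  exact ⟨∅, fun x hx => hx.elim⟩

/-! ### Palindromic and periodic fence matrices -/

section Palindrome

variable (k : ℕ) {near link : ℕ → Bool} {l : ℕ}

theorem det_chainLinkMatrix (j : ℕ) : (chainLinkMatrix k near link j).det = 1 := by
  rw [chainLinkMatrix, chainMatrix, Matrix.det_mul, Matrix.det_pow, det_stepMatrix,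
    det_stepMatrix, one_pow, one_mul]

/-- Transposition reverses a product and complements each step, exactly what the hypotheses say of
the two halves around crossing `l`. The induction grows the fence outward from `l`, one crossing on
each side. -/
theorem fenceMatrix_eq_mul_transpose (hl : 2 ≤ l)
    (hnear : ∀ t, t + 2 < l → near (l + t + 1) = !near (l - (t + 1)))
    (hlink : ∀ t, t + 2 < l → link (l + t) = !link (l - (t + 1))) :
    fenceMatrix k near link 2 (2 * l - 4) =
      consecutiveProd (chainLinkMatrix k near link) 2 (l - 2) * chainMatrix k near l *
        (consecutiveProd (chainLinkMatrix k near link) 2 (l - 2))ᵀ := by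
  have key : ∀ t, t + 2 ≤ l → fenceMatrix k near link (l - t) (2 * t) =
      consecutiveProd (chainLinkMatrix k near link) (l - t) t * chainMatrix k near l *
        (consecutiveProd (chainLinkMatrix k near link) (l - t) t)ᵀ := by
    intro t ht
    induction t with
    | zero => simp [fenceMatrix, consecutiveProd]
    | succ t ih =>
      have ih := ih (by omega)
      have hT : (chainLinkMatrix k near link (l - (t + 1)))ᵀ =
          stepMatrix (link (l + t)) * chainMatrix k near (l + t + 1) := by
        rw [chainLinkMatrix, chainMatrix, Matrix.transpose_mul, Matrix.transpose_pow,
          transpose_stepMatrix, transpose_stepMatrix, chainMatrix, hnear t ht, hlink t ht]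
      rw [fenceMatrix, show 2 * (t + 1) = 1 + 2 * t + 1 by ring, add_comm t 1, consecutiveProd,
        consecutiveProd_add, consecutiveProd_add, consecutiveProd_one, add_comm 1 t,
        show l - (t + 1) + 1 = l - t by omega,
        show l - (t + 1) + (1 + 2 * t) = l + t by omega,
        show l - (t + 1) + (1 + 2 * t + 1) = l + t + 1 by omega,
        Matrix.transpose_mul, hT]
      rw [fenceMatrix, show l - t + 2 * t = l + t by omega] at ih
      rw [chainLinkMatrix.eq_def k near link (l + t)]
      simp only [Matrix.mul_assoc] at ih ⊢
      rw [← Matrix.mul_assoc (consecutiveProd _ _ t)ᵀ]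
      simp only [← Matrix.mul_assoc] at ih ⊢
      simp only [Matrix.mul_assoc (chainLinkMatrix k near link (l - (t + 1)))]
      rw [ih]
  have := key (l - 2) (by omega)
  rwa [show l - (l - 2) = 2 by omega, show 2 * (l - 2) = 2 * l - 4 by omega] at this

/-- The antisymmetric part of `A * X * Aᵀ` is that of `X` multiplied by `A.det`, and `stepMatrix
false ^ k` has off-diagonal difference `-k`. -/
theorem det_and_antisymm_of_palindrome (A : Matrix (Fin 2) (Fin 2) ℤ) (hA : A.det = 1) :
    (A * stepMatrix false ^ k * Aᵀ).det = 1 ∧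
      (A * stepMatrix false ^ k * Aᵀ) 0 1 - (A * stepMatrix false ^ k * Aᵀ) 1 0 = -k := by
  constructor
  · rw [Matrix.det_mul, Matrix.det_mul, Matrix.det_pow, Matrix.det_transpose, hA, det_stepMatrix]
    simp
  · rw [Matrix.det_fin_two] at hA
    rw [stepMatrix_false_pow]
    simp [Matrix.mul_apply, Fin.sum_univ_two]
    linear_combination -(k : ℤ) * hA

/-- A period is one primitive fence followed by the three crossings around an integral point. These
have that point as common right endpoint, so their chains and inner links all read `true`, between
two outer links `false`. -/
theorem fenceMatrix_periodic (hl : 2 ≤ l)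
    (hnear : ∀ j, near (j + 2 * l) = near j) (hlink : ∀ j, link (j + 2 * l) = link j)
    (hn1 : near (2 * l - 1) = true) (hn2 : near (2 * l) = true) (hn3 : near (2 * l + 1) = true)
    (hl0 : link (2 * l - 2) = false) (hl1 : link (2 * l - 1) = true)
    (hl2 : link (2 * l) = true) (hl3 : link (2 * l + 1) = false) (n : ℕ) :
    fenceMatrix k near link 2 (2 * l * n + (2 * l - 4)) =
      (fenceMatrix k near link 2 (2 * l - 4) * detourMatrix k) ^ n *
        fenceMatrix k near link 2 (2 * l - 4) := by
  have hper : ∀ j, chainLinkMatrix k near link (j + 2 * l) = chainLinkMatrix k near link j := by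
    intro j
    rw [chainLinkMatrix, chainMatrix, hnear, hlink, chainLinkMatrix, chainMatrix]
  have hnear' : ∀ j n, near (j + 2 * l * n) = near j := by
    intro j n
    induction n with
    | zero => rfl
    | succ n ih => rw [mul_add, mul_one, ← add_assoc, hnear, ih]
  have hlink' : ∀ j n, link (j + 2 * l * n) = link j := by
    intro j n
    induction n with
    | zero => rfl
    | succ n ih => rw [mul_add, mul_one, ← add_assoc, hlink, ih]
  have hone : consecutiveProd (chainLinkMatrix k near link) 2 (2 * l) =
      fenceMatrix k near link 2 (2 * l - 4) * detourMatrix k := by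
    conv_lhs => rw [show 2 * l = 2 * l - 4 + 4 by omega]
    rw [consecutiveProd_add, show 2 + (2 * l - 4) = 2 * l - 2 by omega]
    simp only [consecutiveProd, one_mul, add_zero]
    rw [show 2 * l - 2 + 1 = 2 * l - 1 by omega, show 2 * l - 2 + 2 = 2 * l by omega,
      show 2 * l - 2 + 3 = 2 * l + 1 by omega]
    rw [fenceMatrix, show 2 + (2 * l - 4) = 2 * l - 2 by omega, detourMatrix]
    simp only [chainLinkMatrix, chainMatrix, hn1, hn2, hn3, hl0, hl1, hl2, hl3]
    -- Three chains of length `k` and the two links between them.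
    rw [show 3 * k + 2 = k + 1 + (k + 1) + k by ring]
    simp only [pow_add, pow_one, Matrix.mul_assoc]
  rw [fenceMatrix, consecutiveProd_add, consecutiveProd_periodic _ _ hper, hone, mul_assoc]
  congr 1
  rw [fenceMatrix]
  congr 1
  · refine consecutiveProd_congr _ _ _ _ _ fun t _ => ?_
    rw [add_right_comm, chainLinkMatrix, chainMatrix, hnear', hlink', chainLinkMatrix, chainMatrix]
  · rw [add_comm (2 * l * n), ← add_assoc, chainMatrix, hnear', chainMatrix]

end Palindrome

/-! ### Scaling, translation and half-turn symmetry of the edges -/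

section FirstSector

theorem nsmul_fst (n : ℕ) (e : Pt) : (n • e).1 = n * e.1 := by
  rw [Prod.smul_fst, nsmul_eq_mul]

theorem nsmul_snd (n : ℕ) (e : Pt) : (n • e).2 = n * e.2 := by
  rw [Prod.smul_snd, nsmul_eq_mul]

variable {e : Pt} (h1 : 0 < e.1) (h2 : 0 ≤ e.2)

theorem edgeNear_even (s : ℕ) :
    edgeNear e (2 * s) = decide (0 < 2 * height e s - (e.1 + e.2)) := by
  rw [edgeNear, (det_edge_even s).1, (det_edge_even s).2]
  congr 2
  ring

theorem edgeNear_odd (s : ℕ) : edgeNear e (2 * s + 1) =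
    decide (0 < 2 * height e s - e.2 - if e.2 < height e s then e.1 + e.2 else 0) := by
  by_cases h : e.2 < height e s
  · rw [edgeNear, (det_edge_odd_of_lt s h).1, (det_edge_odd_of_lt s h).2, if_pos h]
    congr 2
    ring
  · rw [edgeNear, (det_edge_odd_of_le s h).1, (det_edge_odd_of_le s h).2, if_neg h]
    congr 2
    ring

/-- The deciding inequality is homogeneous in `e` and the height, so it survives scaling. The case
`n = 1` yields periodicity, general `n` the passage to multiples. -/
theorem edgeNear_congr {e' : Pt} {i j n : ℕ} (hn : 0 < n) (he : e' = n • e)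
    (hij : i % 2 = j % 2) (h : height e' (i / 2 : ℕ) = n * height e (j / 2 : ℕ)) :
    edgeNear e' i = edgeNear e j := by
  have hn' : (0 : ℤ) < n := by exact_mod_cast hn
  have key : ∀ a b : ℤ, a = n * b → (0 < a ↔ 0 < b) := by
    rintro _ b rfl
    exact mul_pos_iff_of_pos_left hn'
  subst he
  obtain ⟨s, rfl | rfl⟩ := Nat.even_or_odd' i <;> obtain ⟨t, rfl | rfl⟩ := Nat.even_or_odd' j
  · rw [Nat.mul_div_cancel_left _ two_pos, Nat.mul_div_cancel_left _ two_pos] at h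
    rw [edgeNear_even, edgeNear_even, decide_eq_decide, h]
    apply key
    rw [nsmul_fst, nsmul_snd]
    ring
  · omega
  · omega
  · rw [two_mul_add_one_div_two, two_mul_add_one_div_two] at h
    rw [edgeNear_odd, edgeNear_odd, decide_eq_decide, h]
    simp only [nsmul_fst, nsmul_snd, mul_lt_mul_iff_right₀ hn']
    apply key
    split_ifs <;> ring

theorem edgeLink_congr {e' : Pt} {i j n : ℕ} (hn : 0 < n) (he : e' = n • e)
    (hij : i % 2 = j % 2) (h : height e' (i / 2 : ℕ) = n * height e (j / 2 : ℕ)) :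
    edgeLink e' i = edgeLink e j := by
  have hn' : (0 : ℤ) < n := by exact_mod_cast hn
  subst he
  rw [edgeLink, edgeLink, hij, h]
  simp only [nsmul_snd, mul_lt_mul_iff_right₀ hn']

include h1 h2

theorem height_nsmul (n : ℕ) (hn : 0 < n) (s : ℤ) : height (n • e) s = n * height e s := by
  have hn' : (0 : ℤ) < n := by exact_mod_cast hn
  have hp := height_pos h1 h2 s
  have hl := height_le h1 h2 s
  have heq : (n • e).1 * s - ((n • e).1 + (n • e).2) * abscissa e s = n * height e s := by
    rw [height, nsmul_fst, nsmul_snd]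
    ring
  rw [← heq, height, abscissa_eq (e := n • e) (by rw [nsmul_fst]; positivity)
    (by rw [nsmul_snd]; positivity) s
    (abscissa e s)]
  · rw [heq]; positivity
  · rw [heq]
    simp only [nsmul_fst, nsmul_snd, ← mul_add]
    gcongr

theorem edgeNear_nsmul (n : ℕ) (hn : 0 < n) : edgeNear (n • e) = edgeNear e :=
  funext fun _ => edgeNear_congr hn rfl rfl (height_nsmul h1 h2 n hn _)

theorem edgeLink_nsmul (n : ℕ) (hn : 0 < n) : edgeLink (n • e) = edgeLink e :=
  funext fun _ => edgeLink_congr hn rfl rfl (height_nsmul h1 h2 n hn _)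

theorem height_add_period (s : ℤ) : height e (s + (e.1 + e.2)) = height e s := by
  have hp := height_pos h1 h2 s
  have hl := height_le h1 h2 s
  rw [height, abscissa_eq h1 h2 _ (abscissa e s + e.1)] <;> unfold height at * <;> linarith

theorem edge_add_period (l : ℕ) (hl : (l : ℤ) = e.1 + e.2) (j : ℕ) :
    edgeNear e (j + 2 * l) = edgeNear e j ∧ edgeLink e (j + 2 * l) = edgeLink e j := by
  have hh : height e ((j + 2 * l) / 2 : ℕ) = (1 : ℕ) * height e (j / 2 : ℕ) := by
    rw [Nat.add_mul_div_left _ _ two_pos, Nat.cast_add, hl, height_add_period h1 h2]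
    simp
  exact ⟨edgeNear_congr one_pos (one_nsmul e).symm (by omega) hh,
    edgeLink_congr one_pos (one_nsmul e).symm (by omega) hh⟩

omit h1 h2 in
theorem dvd_of_dvd_mul (hc : IsCoprime e.1 e.2) (s : ℤ) (h : e.1 + e.2 ∣ e.1 * s) :
    e.1 + e.2 ∣ s := by
  refine IsCoprime.dvd_of_dvd_mul_left ?_ h
  have := (IsCoprime.add_mul_left_right_iff (x := e.1) (y := e.2) (z := 1)).2 hc
  rw [mul_one, add_comm] at this
  exact this.symm

theorem height_lt (hc : IsCoprime e.1 e.2) (s : ℤ) (hs : 0 < s) (hs' : s < e.1 + e.2) :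
    height e s < e.1 + e.2 := by
  refine (height_le h1 h2 s).lt_of_ne fun h => ?_
  have : e.1 + e.2 ∣ s := dvd_of_dvd_mul hc s ⟨abscissa e s + 1, by unfold height at h; linarith⟩
  exact absurd (Int.le_of_dvd hs this) (by omega)

/-- The half-turn about `e / 2` maps antidiagonal `s` to `e.1 + e.2 - s` and exchanges the sides of
the line. Coprimality excludes integral points on the line in between, which would break the
exchange. -/
theorem height_sub (hc : IsCoprime e.1 e.2) (s : ℤ) (hs : 0 < s) (hs' : s < e.1 + e.2) :
    height e (e.1 + e.2 - s) = e.1 + e.2 - height e s := by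
  have hp := height_pos h1 h2 s
  have hl := height_lt h1 h2 hc s hs hs'
  rw [height, abscissa_eq h1 h2 _ (e.1 - 1 - abscissa e s)] <;> unfold height at * <;> linarith

theorem height_sub_succ (hc : IsCoprime e.1 e.2) (s : ℤ) (hs : 0 ≤ s) (hs' : s + 1 < e.1 + e.2) :
    height e (e.1 + e.2 - 1 - s) =
      e.2 - height e s + if e.2 < height e s then e.1 + e.2 else 0 := by
  rw [show e.1 + e.2 - 1 - s = e.1 + e.2 - (s + 1) by ring,
    height_sub h1 h2 hc (s + 1) (by omega) hs']
  split_ifs with h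
  · rw [height_succ_of_lt h1 h2 s h]; ring
  · rw [height_succ_of_le h1 h2 s h]; ring

/-- The half-turn maps edge `j` to edge `2 * l - j` with left and right exchanged. The strict
inequality is complemented unless the line passes through the midpoint of the edge; that would force
`e.1 + e.2 ∣ j`, which leaves only `j = l` in this range. -/
theorem edgeNear_reverse (hc : IsCoprime e.1 e.2) (l : ℕ) (hl : (l : ℤ) = e.1 + e.2) (j : ℕ)
    (hj : 2 ≤ j) (hj' : j + 2 ≤ 2 * l) (hjl : j ≠ l) :
    edgeNear e (2 * l - j) = !edgeNear e j := by
  have hdvd : ¬ e.1 + e.2 ∣ j := by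
    rintro ⟨c, hjc⟩
    have h0 : 0 < c := by
      by_contra! h
      nlinarith
    have h1' : c < 2 := by
      by_contra! h
      nlinarith
    obtain rfl : c = 1 := by omega
    omega
  obtain ⟨s, rfl | rfl⟩ := Nat.even_or_odd' j
  · rw [show 2 * l - 2 * s = 2 * (l - s) by omega, edgeNear_even, edgeNear_even,
      Nat.cast_sub (by omega), hl, height_sub h1 h2 hc _ (by omega) (by omega), ← decide_not,
      decide_eq_decide]
    have : 2 * height e s ≠ e.1 + e.2 := by
      intro h
      refine hdvd (dvd_of_dvd_mul hc _ ⟨2 * abscissa e s + 1, ?_⟩)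
      unfold height at h
      push_cast
      linarith
    omega
  · have hh := height_sub_succ h1 h2 hc s (by omega) (by omega)
    have hlt := height_lt h1 h2 hc s (by omega) (by omega)
    have hpos := height_pos h1 h2 s
    rw [show 2 * l - (2 * s + 1) = 2 * (l - 1 - s) + 1 by omega, edgeNear_odd, edgeNear_odd,
      Nat.cast_sub (by omega), Nat.cast_sub (by omega), hl, Nat.cast_one, hh, ← decide_not,
      decide_eq_decide]
    have : 2 * height e s - e.2 - (if e.2 < height e s then e.1 + e.2 else 0) ≠ 0 := by
      intro h
      split_ifs at h
      · refine hdvd (dvd_of_dvd_mul hc _ ⟨2 * abscissa e s + 2, ?_⟩)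
        unfold height at h
        push_cast
        linarith
      · refine hdvd (dvd_of_dvd_mul hc _ ⟨2 * abscissa e s + 1, ?_⟩)
        unfold height at h
        push_cast
        linarith
    split_ifs at this ⊢ <;> omega

/-- The central edge is its own image, so the line meets it in its midpoint, and the left
deformation resolves the tie. -/
theorem edgeNear_center (hc : IsCoprime e.1 e.2) (l : ℕ) (hl : (l : ℤ) = e.1 + e.2)
    (hl' : 2 ≤ l) : edgeNear e l = false := by
  obtain ⟨s, hs⟩ := Nat.even_or_odd' l
  rcases hs with rfl | rfl
  · have hh := height_sub h1 h2 hc s (by omega) (by omega)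
    rw [← hl, show ((2 * s : ℕ) : ℤ) - s = s by push_cast; ring] at hh
    rw [edgeNear_even, decide_eq_false_iff_not]
    omega
  · have hh := height_sub_succ h1 h2 hc s (by omega) (by omega)
    rw [← hl, show ((2 * s + 1 : ℕ) : ℤ) - 1 - s = s by push_cast; ring, hl] at hh
    rw [edgeNear_odd, decide_eq_false_iff_not]
    omega

/-- The half-turn carries the common endpoint of two consecutive edges to the other side and swaps
the order of the two edges. -/
theorem edgeLink_reverse (hc : IsCoprime e.1 e.2) (l : ℕ) (hl : (l : ℤ) = e.1 + e.2) (j : ℕ)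
    (hj : 2 ≤ j) (hj' : j + 3 ≤ 2 * l) :
    edgeLink e (2 * l - 1 - j) = !edgeLink e j := by
  have key : ∀ s : ℕ, 1 ≤ s → s + 1 < l →
      (e.2 < height e ((l - 1 - s : ℕ) : ℤ) ↔ e.2 < height e s) := by
    intro s hs hs'
    have hlt := height_lt h1 h2 hc s (by omega) (by omega)
    have hpos := height_pos h1 h2 s
    rw [Nat.cast_sub (by omega), Nat.cast_sub (by omega), hl, Nat.cast_one,
      height_sub_succ h1 h2 hc s (by omega) (by omega)]
    split_ifs with h
    · exact iff_of_true (by omega) h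
    · exact iff_of_false (by omega) h
  obtain ⟨s, rfl | rfl⟩ := Nat.even_or_odd' j
  · rw [show 2 * l - 1 - 2 * s = 2 * (l - 1 - s) + 1 by omega, edgeLink_odd, edgeLink_even]
    simp only [key s (by omega) (by omega)]
  · rw [show 2 * l - 1 - (2 * s + 1) = 2 * (l - 1 - s) by omega, edgeLink_odd, edgeLink_even,
      Bool.not_not]
    simp only [key s (by omega) (by omega)]

theorem height_period : height e (e.1 + e.2) = e.1 + e.2 := by
  rw [height, abscissa_eq h1 h2 _ (e.1 - 1)] <;> linarith

theorem height_period_sub_one (hQ : 0 < e.2) : height e (e.1 + e.2 - 1) = e.2 := by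
  rw [height, abscissa_eq h1 h2 _ (e.1 - 1)] <;> linarith

/-- The fence of a multiple of a primitive vector in the open first sector. -/
theorem fenceMatrix_edge (hQ : 0 < e.2) (l : ℕ) (hl : (l : ℤ) = e.1 + e.2) (k n : ℕ) :
    fenceMatrix k (edgeNear e) (edgeLink e) 2 (2 * l * n + (2 * l - 4)) =
      (fenceMatrix k (edgeNear e) (edgeLink e) 2 (2 * l - 4) * detourMatrix k) ^ n *
        fenceMatrix k (edgeNear e) (edgeLink e) 2 (2 * l - 4) := by
  have ha := height_period h1 h2
  have hb := height_period_sub_one h1 h2 hQ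
  have hb' : height e ((l - 1 : ℕ) : ℤ) = e.2 := by
    rw [Nat.cast_sub (by omega), hl, Nat.cast_one, hb]
  rw [← hl] at ha
  apply fenceMatrix_periodic
  · omega
  · exact fun j => (edge_add_period h1 h2 l hl j).1
  · exact fun j => (edge_add_period h1 h2 l hl j).2
  · rw [show 2 * l - 1 = 2 * (l - 1) + 1 by omega, edgeNear_odd, hb', decide_eq_true_iff]
    simp
    omega
  · rw [edgeNear_even, ha, decide_eq_true_iff]
    omega
  · rw [edgeNear_odd, ha, decide_eq_true_iff]
    split_ifs <;> omega
  · rw [show 2 * l - 2 = 2 * (l - 1) by omega, edgeLink_even, hb']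
    simp
  · rw [show 2 * l - 1 = 2 * (l - 1) + 1 by omega, edgeLink_odd, hb']
    simp
  · rw [edgeLink_even, ha, decide_eq_true_iff]
    omega
  · rw [edgeLink_odd, ha]
    simp
    omega

theorem fenceMatrix_edge_palindrome (hc : IsCoprime e.1 e.2) (hQ : 0 < e.2) (l : ℕ)
    (hl : (l : ℤ) = e.1 + e.2) (k : ℕ) :
    (fenceMatrix k (edgeNear e) (edgeLink e) 2 (2 * l - 4)).det = 1 ∧
      fenceMatrix k (edgeNear e) (edgeLink e) 2 (2 * l - 4) 0 1 -
        fenceMatrix k (edgeNear e) (edgeLink e) 2 (2 * l - 4) 1 0 = -k := by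
  rw [fenceMatrix_eq_mul_transpose k (by omega)]
  · rw [chainMatrix, edgeNear_center h1 h2 hc l hl (by omega)]
    exact det_and_antisymm_of_palindrome k _
      (det_consecutiveProd _ (fun j => det_chainLinkMatrix k j) _ _)
  · intro t ht
    rw [← edgeNear_reverse h1 h2 hc l hl _ (by omega) (by omega) (by omega)]
    congr 1
    omega
  · intro t ht
    rw [← edgeLink_reverse h1 h2 hc l hl _ (by omega) (by omega)]
    congr 1
    omega

end FirstSector

/-! ### Directions along segments of the lattice -/

/-- The fence of a multiple of the primitive vector `(1, 0)`. -/
theorem fenceMatrix_horizontal (k n : ℕ) :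
    fenceMatrix k (edgeNear (1, 0)) (edgeLink (1, 0)) 2 (2 * n + 1) =
      (stepMatrix true ^ (2 * k + 1) * stepMatrix false) ^ n * stepMatrix true ^ (2 * k + 1) := by
  have hh : ∀ s : ℤ, height (1, 0) s = 1 := by
    intro s
    have := height_pos (e := (1, 0)) one_pos le_rfl s
    have := height_le (e := (1, 0)) one_pos le_rfl s
    simp only at *
    omega
  have hnear : ∀ j, edgeNear (1, 0) j = true := by
    intro j
    obtain ⟨s, rfl | rfl⟩ := Nat.even_or_odd' j
    · simp [edgeNear_even, hh]
    · simp [edgeNear_odd, hh]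
  have heven : ∀ s, chainLinkMatrix k (edgeNear (1, 0)) (edgeLink (1, 0)) (2 * s) =
      stepMatrix true ^ (k + 1) := by
    intro s
    rw [chainLinkMatrix, chainMatrix, hnear, edgeLink_even, hh, pow_succ]
    simp
  have hodd : ∀ s, chainLinkMatrix k (edgeNear (1, 0)) (edgeLink (1, 0)) (2 * s + 1) =
      stepMatrix true ^ k * stepMatrix false := by
    intro s
    rw [chainLinkMatrix, chainMatrix, hnear, edgeLink_odd, hh]
    simp
  have hper : ∀ j, chainLinkMatrix k (edgeNear (1, 0)) (edgeLink (1, 0)) (j + 2) =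
      chainLinkMatrix k (edgeNear (1, 0)) (edgeLink (1, 0)) j := by
    intro j
    obtain ⟨s, rfl | rfl⟩ := Nat.even_or_odd' j
    · rw [show 2 * s + 2 = 2 * (s + 1) by ring, heven, heven]
    · rw [show 2 * s + 1 + 2 = 2 * (s + 1) + 1 by ring, hodd, hodd]
  rw [fenceMatrix, consecutiveProd, consecutiveProd_periodic _ _ hper, chainMatrix, hnear,
    show 2 + 2 * n = 2 * (1 + n) by ring, heven]
  have h2 : consecutiveProd (chainLinkMatrix k (edgeNear (1, 0)) (edgeLink (1, 0))) 2 2 =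
      stepMatrix true ^ (2 * k + 1) * stepMatrix false := by
    have e0 := heven 1
    have e1 := hodd 1
    simp only [mul_one] at e0 e1
    simp only [consecutiveProd, one_mul, add_zero]
    rw [e0, e1, ← Matrix.mul_assoc, ← pow_add]
    congr 2
    ring
  rw [h2, Matrix.mul_assoc, ← pow_add]
  congr 2
  ring

/-- The matrix that plays the role of the empty fence of a primitive vector of a segment. -/
def segmentMatrix (k : ℕ) : Matrix (Fin 2) (Fin 2) ℤ := !![(k : ℤ) + 2, -k - 1; -1, 1]

/-- The right side is one period of the horizontal fence: only two edges, antidiagonal and vertical,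
are crossed at each integral point, giving two chains with a link between them and then a link to
the next point. -/
theorem segmentMatrix_mul_detourMatrix (k : ℕ) :
    segmentMatrix k * detourMatrix k = stepMatrix true ^ (2 * k + 1) * stepMatrix false := by
  rw [detourMatrix_eq, segmentMatrix, stepMatrix_true_pow]
  ext i j
  fin_cases i <;> fin_cases j <;> simp [stepMatrix, Matrix.mul_apply, Fin.sum_univ_two] <;> ring

/-- `stepMatrix false * segmentMatrix k` has row sums `1`, so it fixes the all-ones vector. -/
theorem entrySum_mul_false_mul_segmentMatrix (k : ℕ) (Y : Matrix (Fin 2) (Fin 2) ℤ) :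
    entrySum (Y * (stepMatrix false * segmentMatrix k)) = entrySum Y := by
  simp [entrySum, segmentMatrix, stepMatrix, Matrix.mul_apply, Fin.sum_univ_two]
  ring

/-! ### Assembly -/

theorem m_eq_ncard (k : ℕ) (d : Pt) (hd : d ≠ 0) :
    m k d.1 d.2 = (orderIdeals k d).ncard := by
  rw [m, if_neg]
  rintro ⟨h, h'⟩
  exact hd (Prod.ext h h')

theorem ne_zero_of_isCoprime (p q : ℤ) (hpq : IsCoprime p q) : ((p, q) : Pt) ≠ 0 := by
  intro h
  obtain ⟨rfl, rfl⟩ := Prod.mk.inj h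
  obtain ⟨a, b, hab⟩ := hpq
  simp at hab

/-- The numbers of order ideals for the multiples of a primitive vector are given by powers of a
unimodular matrix. -/
theorem exists_matrix (k : ℕ) (p q : ℤ) (hpq : IsCoprime p q) :
    ∃ M : Matrix (Fin 2) (Fin 2) ℤ, M.det = 1 ∧ M 0 1 - M 1 0 = -k ∧
      ∀ n : ℕ, (m k ((n + 1 : ℕ) * p) ((n + 1 : ℕ) * q) : ℤ) =
        entrySum ((M * detourMatrix k) ^ n * M) := by
  have hd := ne_zero_of_isCoprime p q hpq
  obtain ⟨ρ, e, hρ, hρe, h1, h2⟩ := exists_isLatticeRotation (p, q) hd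
  have hc : IsCoprime e.1 e.2 := by
    obtain ⟨a, b, hab⟩ := hpq
    -- The Bézout relation says `det (b, -a) (p, q) = 1`, and the rotation preserves determinants.
    obtain ⟨u, hu⟩ := ρ.surjective (b, -a)
    have : det u e = 1 := by
      rw [← hρ.1, hu, hρe]
      simp only [det]
      linarith
    exact ⟨-u.2, u.1, by simp only [det] at this; linarith⟩
  have hm : ∀ n : ℕ, m k ((n + 1 : ℕ) * p) ((n + 1 : ℕ) * q) =
      (orderIdeals k (ρ ((n + 1) • e))).ncard := by
    intro n
    have : ρ ((n + 1) • e) = ((n + 1 : ℕ) * p, (n + 1 : ℕ) * q) := by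
      rw [map_nsmul, hρe]
      simp
    rw [this, ← m_eq_ncard]
    rw [← this, Ne, EmbeddingLike.map_eq_zero_iff]
    intro h
    have := congrArg Prod.fst h
    simp at this
    omega
  have h1' : ∀ n : ℕ, 0 < ((n + 1) • e).1 := by
    intro n
    simp only [nsmul_fst]
    positivity
  have h2' : ∀ n : ℕ, 0 ≤ ((n + 1) • e).2 := by
    intro n
    simp only [nsmul_snd]
    positivity
  rcases h2.lt_or_eq with hQ | hQ
  · obtain ⟨l, hl⟩ := Int.eq_ofNat_of_zero_le (show 0 ≤ e.1 + e.2 by omega)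
    have hpal := fenceMatrix_edge_palindrome h1 h2 hc hQ l hl.symm k
    refine ⟨_, hpal.1, hpal.2, fun n => ?_⟩
    rw [hm, ncard_orderIdeals_edge hρ (h1' n) (h2' n) k (2 * l * n + (2 * l - 4)),
      edgeNear_nsmul h1 h2 _ n.succ_pos, edgeLink_nsmul h1 h2 _ n.succ_pos,
      fenceMatrix_edge h1 h2 hQ l hl.symm]
    have h0 : ((n + 1) • e).2 ≠ 0 := by
      simp only [nsmul_snd]
      positivity
    rw [if_neg h0]
    rw [nsmul_fst, nsmul_snd, ← mul_add, hl]
    rw [Nat.cast_add, Nat.cast_sub (by omega)]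
    push_cast
    ring
  · obtain ⟨P, Q⟩ := e
    simp only at hQ h1 hc
    subst hQ
    obtain rfl : P = 1 := by
      rw [isCoprime_zero_right, Int.isUnit_iff] at hc
      omega
    refine ⟨segmentMatrix k, ?_, ?_, fun n => ?_⟩
    · rw [Matrix.det_fin_two]
      simp [segmentMatrix]
      ring
    · simp [segmentMatrix]
    · rw [hm]
      cases n with
      | zero =>
        rw [ncard_orderIdeals_of_eq_one hρ (h1' 0) (h2' 0) k (by simp) (by simp)]
        simp [segmentMatrix, entrySum]
        ring
      | succ n =>
        rw [ncard_orderIdeals_edge hρ (h1' _) (h2' _) k (2 * n + 1) (by simp; ring),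
          edgeNear_nsmul one_pos le_rfl _ (Nat.succ_pos _),
          edgeLink_nsmul one_pos le_rfl _ (Nat.succ_pos _), fenceMatrix_horizontal,
          segmentMatrix_mul_detourMatrix, pow_succ _ n,
          ← entrySum_mul_false_mul_segmentMatrix k]
        simp only [mul_assoc]

theorem m_pos (k : ℕ) (p q : ℤ) (hpq : IsCoprime p q) : 0 < m k p q := by
  have hd := ne_zero_of_isCoprime p q hpq
  rw [m_eq_ncard k (p, q) hd]
  exact ncard_orderIdeals_pos k _ hd

end KMarkov

theorem proposition3 (k : ℕ) (p q : ℤ) (hpq : IsCoprime p q)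
    (η : ℝ) (hη : η = (3 + 3 * (k : ℝ)) * (KMarkov.m k p q : ℝ) - (k : ℝ)) :
    (KMarkov.m k (((0 : ℕ) : ℤ) * p) (((0 : ℕ) : ℤ) * q) = 0 ∧
      KMarkov.m k (((1 : ℕ) : ℤ) * p) (((1 : ℕ) : ℤ) * q) = KMarkov.m k p q ∧
      ∀ n : ℕ,
        (KMarkov.m k (((n + 2 : ℕ) : ℤ) * p) (((n + 2 : ℕ) : ℤ) * q) : ℤ) =
          ((3 + 3 * (k : ℤ)) * (KMarkov.m k p q : ℤ) - (k : ℤ)) *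
              (KMarkov.m k (((n + 1 : ℕ) : ℤ) * p) (((n + 1 : ℕ) : ℤ) * q) : ℤ) -
            (KMarkov.m k ((n : ℤ) * p) ((n : ℤ) * q) : ℤ)) ∧
    (2 < η ∧
      ∀ n : ℕ,
        (KMarkov.m k ((n : ℤ) * p) ((n : ℤ) * q) : ℝ) =
          (KMarkov.m k p q : ℝ) / √(η ^ 2 - 4) * ((η + √(η ^ 2 - 4)) / 2) ^ n -
            (KMarkov.m k p q : ℝ) / √(η ^ 2 - 4) * ((η - √(η ^ 2 - 4)) / 2) ^ n) := by
  have h0 : KMarkov.m k (((0 : ℕ) : ℤ) * p) (((0 : ℕ) : ℤ) * q) = 0 := by simp [KMarkov.m]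
  have h1 : KMarkov.m k (((1 : ℕ) : ℤ) * p) (((1 : ℕ) : ℤ) * q) = KMarkov.m k p q := by simp
  have hrec : ∀ n : ℕ,
      (KMarkov.m k (((n + 2 : ℕ) : ℤ) * p) (((n + 2 : ℕ) : ℤ) * q) : ℤ) =
        ((3 + 3 * (k : ℤ)) * (KMarkov.m k p q : ℤ) - (k : ℤ)) *
            (KMarkov.m k (((n + 1 : ℕ) : ℤ) * p) (((n + 1 : ℕ) : ℤ) * q) : ℤ) -
          (KMarkov.m k ((n : ℤ) * p) ((n : ℤ) * q) : ℤ) := by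
    obtain ⟨M, hdet, hM, hm⟩ := KMarkov.exists_matrix k p q hpq
    have hr := KMarkov.entrySum_recurrence k M hdet hM
    have hm0 := hm 0
    rw [pow_zero, one_mul, zero_add, h1] at hm0
    rw [← hm0] at hr
    intro n
    cases n with
    | zero =>
      -- The value at the origin is not among the terms of `hm`, so the separate first conjunct is
      -- used.
      rw [h0, zero_add, zero_add, h1, hm 1, hr.1]
      simp
    | succ n => rw [hm (n + 2), hm (n + 1), hm n, hr.2]
  have hpos : (1 : ℝ) ≤ KMarkov.m k p q := by exact_mod_cast KMarkov.m_pos k p q hpq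
  have hη2 : 2 < η := by
    rw [hη]
    -- Since `m ≥ 1`, `η ≥ 3 + 2 * k`.
    nlinarith [(Nat.cast_nonneg k : (0 : ℝ) ≤ k)]
  refine ⟨⟨h0, h1, hrec⟩, hη2, fun n => ?_⟩
  have := KMarkov.closed_form (fun n : ℕ => (KMarkov.m k ((n : ℤ) * p) ((n : ℤ) * q) : ℝ)) η hη2
    (by exact_mod_cast h0) (fun n => by
      rw [hη]
      exact_mod_cast hrec n) n
  simp only [h1] at this
  exact this
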